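/- A product state in $(\mathbb{C}^2)^{\otimes p}$ is a unit vector of the form $v_1 \otimes \cdots \otimes v_p$ with $v_j \in \mathbb{C}^2$ for all $j$. An unextendible product basis in $(\mathbb{C}^2)^{\otimes p}$ is an orthonormal set $S \subseteq (\mathbb{C}^2)^{\otimes p}$ of product states such that no product state is orthogonal to every member of $S$. For $p \geq 1$, let $f(p)$ be the smallest possible number of states in an unextendible product basis in $(\mathbb{C}^2)^{\otimes p}$. Then: (a) if $p$ is odd, then $f(p) = p + 1$; (b) if $p = 4$ or $p \equiv 2 \pmod 4$, then $f(p) = p + 2$; (c) if $p = 8$, then $f(p) = p + 3 = 11$; (d) in all other cases, that is, if $p \equiv 0 \pmod 4$ and $p \geq 12$, then $f(p) = p + 4$. -/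

import Mathlib

open scoped TensorProduct

noncomputable section

/-- The state space of a single qubit: `ℂ²` with its Euclidean inner product. -/
abbrev Qubit : Type := EuclideanSpace ℂ (Fin 2)

/-- The state space of `p` qubits: the tensor product `(ℂ²)^{⊗ p}`. -/
abbrev Qubits (p : ℕ) : Type := ⨂[ℂ] _ : Fin p, Qubit

/-- The computational basis of `(ℂ²)^{⊗ p}`, indexed by bit strings of length `p`: the basis vector
of the bit string `x` is `e_{x 0} ⊗ ⋯ ⊗ e_{x (p - 1)}`. -/
def computationalBasis (p : ℕ) : Module.Basis (Fin p → Fin 2) ℂ (Qubits p) :=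
  Basis.piTensorProduct fun _ : Fin p => (EuclideanSpace.basisFun (Fin 2) ℂ).toBasis

/-- The Hilbert space inner product `⟨φ, ψ⟩` of `(ℂ²)^{⊗ p}`, conjugate-linear in the first
argument: the one for which the computational basis is orthonormal. -/
def braket {p : ℕ} (φ ψ : Qubits p) : ℂ :=
  ∑ x : Fin p → Fin 2,
    starRingEnd ℂ ((computationalBasis p).repr φ x) * (computationalBasis p).repr ψ x

/-- The inner product is the tensor product of the inner products of the factors. -/
theorem braket_tprod {p : ℕ} (v w : Fin p → Qubit) :
    braket (PiTensorProduct.tprod ℂ v) (PiTensorProduct.tprod ℂ w) = ∏ j, inner ℂ (v j) (w j) := by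
  simp only [braket, computationalBasis, Basis.piTensorProduct_repr_tprod_apply, map_prod,
    ← Finset.prod_mul_distrib]
  rw [← Fintype.piFinset_univ, ← Finset.prod_univ_sum (fun _ : Fin p => Finset.univ)
    (fun j (b : Fin 2) => starRingEnd ℂ
      ((EuclideanSpace.basisFun (Fin 2) ℂ).toBasis.repr (v j) b) *
      (EuclideanSpace.basisFun (Fin 2) ℂ).toBasis.repr (w j) b)]
  refine Finset.prod_congr rfl fun j _ => ?_
  simp [PiLp.inner_apply, mul_comm]

/-- A product state: a unit vector of the form `v₁ ⊗ ⋯ ⊗ v_p` with all `v_j ∈ ℂ²`. -/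
def IsProductState {p : ℕ} (ψ : Qubits p) : Prop :=
  braket ψ ψ = 1 ∧ ∃ v : Fin p → Qubit, ψ = PiTensorProduct.tprod ℂ v

/-- An unextendible product basis: an orthonormal set of product states (they are unit vectors by
definition) such that no product state is orthogonal to every member of it. -/
structure IsUPB {p : ℕ} (S : Set (Qubits p)) : Prop where
  isProductState : ∀ ψ ∈ S, IsProductState ψ
  orthogonal : ∀ φ ∈ S, ∀ ψ ∈ S, φ ≠ ψ → braket φ ψ = 0
  unextendible : ¬ ∃ φ : Qubits p, IsProductState φ ∧ ∀ ψ ∈ S, braket ψ φ = 0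

/-- The possible numbers of states in an unextendible product basis in `(ℂ²)^{⊗ p}`. -/
def upbSizes (p : ℕ) : Set ℕ :=
  {n | ∃ S : Set (Qubits p), IsUPB S ∧ S.encard = n}

end

/-! ### From product bases to colourings by lines -/

/-- A combinatorial model of an unextendible product basis of qubits: the colour `c j x` stands for the
line spanned by the `j`-th factor of the state `x`, and `σ` for the orthogonal complement of a line. -/
structure IsUPBColoring {L ι V : Type*} (σ : L → L) (c : ι → V → L) : Prop where
  invol : ∀ l, σ (σ l) = l
  ne : ∀ l, σ l ≠ l
  orth : ∀ x y, x ≠ y → ∃ j, c j y = σ (c j x)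
  unext : ∀ d : ι → L, ∃ x, ∀ j, c j x ≠ d j

/-- The slope of the line spanned by a vector of `ℂ²`, with `none` for the slope at infinity. -/
noncomputable def slope₂ (v : Qubit) : Option ℂ := by
  classical exact if v 0 = 0 then none else some (v 1 / v 0)

/-- The slope of the orthogonal complement of a line of given slope. -/
noncomputable def perpSlope : Option ℂ → Option ℂ
  | none => some 0
  | some z => by classical exact if z = 0 then none else some (-(starRingEnd ℂ z)⁻¹)

theorem perpSlope_perpSlope (l : Option ℂ) : perpSlope (perpSlope l) = l := by
  rcases l with _ | z
  · simp [perpSlope]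
  · by_cases hz : z = 0 <;> simp [perpSlope, hz]

theorem perpSlope_ne (l : Option ℂ) : perpSlope l ≠ l := by
  rcases l with _ | z
  · simp [perpSlope]
  · by_cases hz : z = 0
    · simp [perpSlope, hz]
    · simp only [perpSlope, hz, if_false, ne_eq, Option.some.injEq]
      intro h
      have hc : starRingEnd ℂ z ≠ 0 := by simpa using hz
      have h1 : z * starRingEnd ℂ z = -1 := by
        nth_rewrite 1 [← h]
        field_simp
      rw [Complex.mul_conj] at h1
      have h2 : Complex.normSq z = -1 := by exact_mod_cast h1
      linarith [Complex.normSq_nonneg z]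

theorem exists_slope₂_eq (l : Option ℂ) : ∃ v : Qubit, v ≠ 0 ∧ slope₂ v = l := by
  rcases l with _ | z
  · refine ⟨!₂[0, 1], ?_, by simp [slope₂]⟩
    intro h
    have := congrArg (fun v : Qubit => v 1) h
    simp at this
  · refine ⟨!₂[1, z], ?_, by simp [slope₂]⟩
    intro h
    have := congrArg (fun v : Qubit => v 0) h
    simp at this

theorem qubit_inner (v w : Qubit) :
    inner ℂ v w = w 0 * starRingEnd ℂ (v 0) + w 1 * starRingEnd ℂ (v 1) := by
  simp [PiLp.inner_apply, Fin.sum_univ_two]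

theorem qubit_ne_zero {v : Qubit} (hv : v ≠ 0) : v 0 ≠ 0 ∨ v 1 ≠ 0 := by
  by_contra! h
  apply hv
  ext i
  fin_cases i <;> simp [h.1, h.2]

theorem inner_eq_zero_iff_slope₂ {v w : Qubit} (hv : v ≠ 0) (hw : w ≠ 0) :
    inner ℂ v w = 0 ↔ slope₂ w = perpSlope (slope₂ v) := by
  have hv' := qubit_ne_zero hv
  have hw' := qubit_ne_zero hw
  rw [qubit_inner]
  by_cases hv0 : v 0 = 0
  · have hv1 : v 1 ≠ 0 := by tauto
    by_cases hw0 : w 0 = 0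
    · have hw1 : w 1 ≠ 0 := by tauto
      simp [slope₂, hv0, hw0, perpSlope, hv1, hw1]
    · simp [slope₂, hv0, hw0, perpSlope, hv1]
  · by_cases hv1 : v 1 = 0
    · by_cases hw0 : w 0 = 0
      · simp [slope₂, hv0, hv1, hw0, perpSlope]
      · simp [slope₂, hv0, hv1, hw0, perpSlope]
    · have c0 : starRingEnd ℂ (v 0) ≠ 0 := by simpa using hv0
      have c1 : starRingEnd ℂ (v 1) ≠ 0 := by simpa using hv1
      by_cases hw0 : w 0 = 0
      · have hw1 : w 1 ≠ 0 := by tauto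
        simp [slope₂, hv0, hv1, hw0, hw1, perpSlope]
      · simp only [slope₂, hv0, hw0, perpSlope, if_false, div_eq_zero_iff, hv1, or_self, map_div₀,
          inv_div, Option.some.injEq]
        rw [div_eq_iff hw0, ← neg_div, div_mul_eq_mul_div, eq_div_iff c1]
        constructor <;> intro h <;> linear_combination h

theorem IsProductState.inner_self_ne_zero {p : ℕ} {v : Fin p → Qubit}
    (h : IsProductState (PiTensorProduct.tprod ℂ v)) (j : Fin p) : v j ≠ 0 := by
  have h1 := h.1
  rw [braket_tprod] at h1
  intro hj
  rw [Finset.prod_eq_zero (Finset.mem_univ j) (by simp [hj])] at h1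
  exact zero_ne_one h1

theorem isProductState_tprod {p : ℕ} {v : Fin p → Qubit} (h : ∀ j, ‖v j‖ = 1) :
    IsProductState (PiTensorProduct.tprod ℂ v) := by
  refine ⟨?_, v, rfl⟩
  rw [braket_tprod]
  exact Finset.prod_eq_one fun j _ => by rw [inner_self_eq_norm_sq_to_K, h j]; simp

theorem exists_isUPBColoring {p n : ℕ} (h : n ∈ upbSizes p) :
    ∃ c : Fin p → Fin n → Option ℂ, IsUPBColoring perpSlope c := by
  obtain ⟨S, hS, hn⟩ := h
  have hfin : S.Finite := Set.finite_of_encard_eq_coe hn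
  have hcard : Nat.card S = n := by
    rw [Nat.card_coe_set_eq, Set.ncard_def, hn]; rfl
  have : Finite S := hfin
  let e : Fin n ≃ S := (Finite.equivFinOfCardEq hcard).symm
  choose v hv using fun x : Fin n => (hS.isProductState _ (e x).2).2
  have hps : ∀ x, IsProductState (PiTensorProduct.tprod ℂ (v x)) := fun x => by
    rw [← hv]; exact hS.isProductState _ (e x).2
  refine ⟨fun j x => slope₂ (v x j), perpSlope_perpSlope, perpSlope_ne, ?_, ?_⟩
  · intro x y hxy
    have h0 := hS.orthogonal _ (e x).2 _ (e y).2 (fun h => hxy (e.injective (Subtype.ext h)))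
    rw [hv, hv, braket_tprod, Finset.prod_eq_zero_iff] at h0
    obtain ⟨j, -, hj⟩ := h0
    exact ⟨j, (inner_eq_zero_iff_slope₂ ((hps x).inner_self_ne_zero j)
      ((hps y).inner_self_ne_zero j)).1 hj⟩
  · intro d
    by_contra! hd
    -- If the colours `d j` met every state, the product of vectors orthogonal to these lines would
    -- extend the basis.
    choose w hw0 hw using fun j => exists_slope₂_eq (perpSlope (d j))
    let u : Fin p → Qubit := fun j => ((‖w j‖ : ℂ)⁻¹) • w j
    have hu : ∀ j, ‖u j‖ = 1 := fun j => by
      have : ‖w j‖ ≠ 0 := by simpa using hw0 j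
      simp [u, norm_smul, this]
    refine hS.unextendible ⟨PiTensorProduct.tprod ℂ u, isProductState_tprod hu, ?_⟩
    intro ψ hψ
    obtain ⟨x, hx⟩ := e.surjective ⟨ψ, hψ⟩
    obtain ⟨j, hj⟩ := hd x
    have : ψ = PiTensorProduct.tprod ℂ (v x) := by rw [← hv, hx]
    rw [this, braket_tprod]
    refine Finset.prod_eq_zero (Finset.mem_univ j) ?_
    rw [inner_smul_right, (inner_eq_zero_iff_slope₂ ((hps x).inner_self_ne_zero j) (hw0 j)).2
      (by rw [hw, hj]), mul_zero]

/-! ### From colourings to product bases -/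

/-- Unit vectors `(1, l) / √(1 + l²)` and `(-l, 1) / √(1 + l²)`, indexed by `l` and a side. -/
noncomputable def sideVector (a : ℕ × Bool) : Qubit :=
  ((Real.sqrt (1 + (a.1 : ℝ) ^ 2) : ℂ)⁻¹) • (if a.2 then !₂[-(a.1 : ℂ), 1] else !₂[1, (a.1 : ℂ)])

theorem norm_sideVector (a : ℕ × Bool) : ‖sideVector a‖ = 1 := by
  have h : (0 : ℝ) < 1 + (a.1 : ℝ) ^ 2 := by positivity
  have h2 : Real.sqrt (1 + (a.1 : ℝ) ^ 2) ≠ 0 := (Real.sqrt_pos.2 h).ne'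
  have h3 : ‖(Real.sqrt (1 + (a.1 : ℝ) ^ 2) : ℂ)‖ = Real.sqrt (1 + (a.1 : ℝ) ^ 2) := by
    rw [Complex.norm_real, Real.norm_of_nonneg (Real.sqrt_nonneg _)]
  rw [sideVector, norm_smul, norm_inv, h3]
  split_ifs <;> rw [EuclideanSpace.norm_eq, Fin.sum_univ_two] <;> simp [add_comm] <;>
    · rw [inv_mul_cancel₀]
      simpa [add_comm] using h2

theorem inner_sideVector_eq_zero_iff (a : ℕ × Bool) (w : Qubit) :
    inner ℂ (sideVector a) w = 0 ↔
      if a.2 then w 1 = a.1 * w 0 else w 0 + a.1 * w 1 = 0 := by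
  have h : (0 : ℝ) < 1 + (a.1 : ℝ) ^ 2 := by positivity
  have h2 : (Real.sqrt (1 + (a.1 : ℝ) ^ 2) : ℂ) ≠ 0 := by
    exact_mod_cast (Real.sqrt_pos.2 h).ne'
  rw [sideVector, inner_smul_left, mul_eq_zero, or_iff_right (by simpa using h2), qubit_inner]
  split_ifs
  · simp
    constructor <;> intro h <;> linear_combination h
  · simp [mul_comm]

theorem inner_sideVector {l : ℕ} {a b : Bool} (h : a ≠ b) :
    inner ℂ (sideVector (l, a)) (sideVector (l, b)) = 0 := by
  rw [inner_sideVector_eq_zero_iff]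
  cases a <;> cases b <;> simp [sideVector] at h ⊢
  · ring
  · ring

/-- Different side vectors are not parallel: `(1, k)` and `(-l, 1)` have determinant `1 + k * l ≠
0`, and on one side the labels are slopes up to a quarter turn. So a nonzero vector of the plane is
orthogonal to at most one of them. -/
theorem eq_of_inner_sideVector_eq_zero {a b : ℕ × Bool} {w : Qubit} (hw : w ≠ 0)
    (ha : inner ℂ (sideVector a) w = 0) (hb : inner ℂ (sideVector b) w = 0) : a = b := by
  rw [inner_sideVector_eq_zero_iff] at ha hb
  obtain ⟨k, s⟩ := a
  obtain ⟨l, t⟩ := b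
  have hw' := qubit_ne_zero hw
  have hkl : (1 + k * l : ℂ) ≠ 0 := by
    have : ((1 + k * l : ℕ) : ℂ) ≠ 0 := Nat.cast_ne_zero.2 (by positivity)
    exact_mod_cast this
  cases s <;> cases t <;> simp at ha hb ⊢
  · have : ((k : ℂ) - l) * w 1 = 0 := by linear_combination ha - hb
    rcases mul_eq_zero.1 this with h | h
    · exact_mod_cast sub_eq_zero.1 h
    · rw [h] at ha; simp [h] at ha hw'; exact absurd ha hw'
  · have : (1 + k * l : ℂ) * w 0 = 0 := by linear_combination ha - k * hb
    have h0 := (mul_eq_zero.1 this).resolve_left hkl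
    rw [h0] at hb; simp at hb; simp [h0, hb] at hw'
  · have : (1 + k * l : ℂ) * w 0 = 0 := by linear_combination hb - l * ha
    have h0 := (mul_eq_zero.1 this).resolve_left hkl
    rw [h0] at ha; simp at ha; simp [h0, ha] at hw'
  · have : ((k : ℂ) - l) * w 0 = 0 := by linear_combination hb - ha
    rcases mul_eq_zero.1 this with h | h
    · exact_mod_cast sub_eq_zero.1 h
    · rw [h] at ha; simp at ha; simp [h, ha] at hw'

theorem card_mem_upbSizes {p : ℕ} {ι V : Type*} [Fintype ι] [Fintype V] {κ : Type*} [Countable κ] [Nonempty κ]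
    (hp : Fintype.card ι = p) (c : ι → V → κ × Bool)
    (horth : ∀ x y, x ≠ y → ∃ j, (c j x).1 = (c j y).1 ∧ (c j x).2 ≠ (c j y).2)
    (hunext : ∀ d : ι → κ × Bool, ∃ x, ∀ j, c j x ≠ d j) :
    Fintype.card V ∈ upbSizes p := by
  classical
  obtain ⟨f, hf⟩ := exists_injective_nat κ
  let e : Fin p ≃ ι := (Fintype.equivFinOfCardEq hp).symm
  let v : V → Fin p → Qubit := fun x j => sideVector (f (c (e j) x).1, (c (e j) x).2)
  let ψ : V → Qubits p := fun x => PiTensorProduct.tprod ℂ (v x)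
  have hps : ∀ x, IsProductState (ψ x) := fun x => isProductState_tprod fun j => norm_sideVector _
  have ho : ∀ x y, x ≠ y → braket (ψ x) (ψ y) = 0 := fun x y hxy => by
    obtain ⟨j, hj1, hj2⟩ := horth x y hxy
    rw [braket_tprod]
    refine Finset.prod_eq_zero (Finset.mem_univ (e.symm j)) ?_
    simp only [v, Equiv.apply_symm_apply, hj1]
    exact inner_sideVector hj2
  have hinj : Function.Injective ψ := fun x y hxy => by
    by_contra hne
    have h := ho x y hne
    rw [← hxy, (hps x).1] at h
    exact one_ne_zero h
  refine ⟨Set.range ψ, ⟨?_, ?_, ?_⟩, ?_⟩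
  · rintro _ ⟨x, rfl⟩; exact hps x
  · rintro _ ⟨x, rfl⟩ _ ⟨y, rfl⟩ hxy
    exact ho x y fun h => hxy (by rw [h])
  · rintro ⟨φ, hφ, hφ0⟩
    obtain ⟨w, rfl⟩ := hφ.2
    let Q : ι → κ × Bool → Prop := fun j a => inner ℂ (sideVector (f a.1, a.2)) (w (e.symm j)) = 0
    -- The factor at a qubit is orthogonal to at most one side vector. Where there is none the
    -- colour is arbitrary: no state is orthogonal to the factor there.
    obtain ⟨x, hx⟩ := hunext fun j => if h : ∃ a, Q j a then h.choose else Classical.arbitrary _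
    have h0 := hφ0 (ψ x) ⟨x, rfl⟩
    rw [braket_tprod, Finset.prod_eq_zero_iff] at h0
    obtain ⟨j, -, hj⟩ := h0
    have hQ : Q (e j) (c (e j) x) := by simpa [Q, v] using hj
    have hex : ∃ a, Q (e j) a := ⟨_, hQ⟩
    refine hx (e j) ?_
    rw [dif_pos hex]
    have h1 := hex.choose_spec
    have h2 := eq_of_inner_sideVector_eq_zero (hφ.inner_self_ne_zero _) hQ h1
    rw [Prod.mk.injEq] at h2
    exact Prod.ext (hf h2.1) h2.2
  · rw [← Set.image_univ, hinj.encard_image, Set.encard_univ]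
    simp

/-! ### Constructions from one-factorizations -/

/-- This union bound gives unextendibility in both infinite families, each time with just one point
to spare. -/
theorem exists_forall_ne_of_sum_lt {ι V K : Type*} [Fintype ι] [Fintype V] [DecidableEq K]
    (c : ι → V → K) (s : ι → ℕ) (hs : ∀ j l, (Finset.univ.filter fun x => c j x = l).card ≤ s j)
    (h : ∑ j, s j < Fintype.card V) (d : ι → K) : ∃ x, ∀ j, c j x ≠ d j := by
  classical
  by_contra! hd
  have h1 : (Finset.univ : Finset V) ⊆
      Finset.univ.biUnion fun j => Finset.univ.filter fun x => c j x = d j := fun x _ => by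
    obtain ⟨j, hj⟩ := hd x
    simpa using ⟨j, hj⟩
  have h2 := (Finset.card_le_card h1).trans Finset.card_biUnion_le
  have h3 := h2.trans (Finset.sum_le_sum fun j _ => hs j (d j))
  rw [Finset.card_univ] at h3
  omega

/-- The involutions of the round-robin one-factorization of the complete graph on
`ℤ/q ∪ {∞}`, for odd `q`. -/
def roundRobin {q : ℕ} (j : ZMod q) : Option (ZMod q) → Option (ZMod q)
  | none => some j
  | some x => if x = j then none else some (2 * j - x)

theorem roundRobin_roundRobin {q : ℕ} (j : ZMod q) (x : Option (ZMod q)) :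
    roundRobin j (roundRobin j x) = x := by
  rcases x with _ | x
  · simp [roundRobin]
  · by_cases h : x = j
    · simp [roundRobin, h]
    · have : 2 * j - x ≠ j := fun h' => h (by linear_combination -h')
      simp [roundRobin, h, this]

theorem isUnit_two_of_odd {q : ℕ} (hq : Odd q) : IsUnit (2 : ZMod q) := by
  have := (ZMod.isUnit_iff_coprime 2 q).2 (Nat.coprime_two_left.2 hq)
  exact_mod_cast this

theorem roundRobin_ne {q : ℕ} (hq : Odd q) (j : ZMod q) (x : Option (ZMod q)) :
    roundRobin j x ≠ x := by
  rcases x with _ | x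
  · simp [roundRobin]
  · by_cases h : x = j
    · simp [roundRobin, h]
    · simp only [roundRobin, h, if_false, ne_eq, Option.some.injEq]
      intro h'
      apply h
      apply (isUnit_two_of_odd hq).mul_left_cancel
      linear_combination -h'

theorem exists_roundRobin_eq {q : ℕ} (hq : Odd q) {x y : Option (ZMod q)} (hxy : x ≠ y) :
    ∃ j, roundRobin j x = y := by
  rcases x with _ | x <;> rcases y with _ | y
  · exact absurd rfl hxy
  · exact ⟨y, rfl⟩
  · exact ⟨x, by simp [roundRobin]⟩
  · obtain ⟨u, hu⟩ := (isUnit_two_of_odd hq).exists_right_inv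
    -- As `u` inverts `2`, this round is the midpoint of `x` and `y`.
    refine ⟨u * (x + y), ?_⟩
    have hne : x ≠ u * (x + y) := fun h => hxy (by
      congr 1
      linear_combination 2 * h + (x + y) * hu)
    simp only [roundRobin, hne, if_false, Option.some.injEq]
    linear_combination (x + y) * hu

/-- The two ends of each edge of a matching, given as an involution `τ`, get the same label and
different sides. -/
def matchingColor {V : Type*} [LinearOrder V] (τ : V → V) (x : V) : V × Bool :=
  (min x (τ x), decide (x < τ x))

section matchingColor

variable {V : Type*} [LinearOrder V] {τ : V → V}

theorem matchingColor_fst (hτ : ∀ x, τ (τ x) = x) (x : V) :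
    (matchingColor τ x).1 = (matchingColor τ (τ x)).1 := by
  simp [matchingColor, hτ, min_comm]

theorem matchingColor_snd (hτ : ∀ x, τ (τ x) = x) (hne : ∀ x, τ x ≠ x) (x : V) :
    (matchingColor τ x).2 ≠ (matchingColor τ (τ x)).2 := by
  rcases lt_or_gt_of_ne (hne x) with h | h <;> simp [matchingColor, hτ, h, h.le]

theorem matchingColor_injective (hτ : ∀ x, τ (τ x) = x) :
    Function.Injective (matchingColor τ) := by
  intro x y h
  simp only [matchingColor, Prod.mk.injEq, decide_eq_decide] at h
  obtain ⟨h1, h2⟩ := h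
  by_cases hx : x < τ x
  · have hy := h2.1 hx
    rwa [min_eq_left hx.le, min_eq_left hy.le] at h1
  · have hy := fun h => hx (h2.2 h)
    rw [min_eq_right (not_lt.1 hx), min_eq_right (not_lt.1 hy)] at h1
    rw [← hτ x, h1, hτ]

end matchingColor

theorem card_filter_le_one_of_injective {V K : Type*} [Fintype V] [DecidableEq K] {f : V → K}
    (hf : Function.Injective f) (l : K) : (Finset.univ.filter fun x => f x = l).card ≤ 1 := by
  rw [Finset.card_le_one]
  intro a ha b hb
  simp at ha hb
  exact hf (ha.trans hb.symm)

theorem succ_mem_upbSizes_of_odd {q : ℕ} (hq : Odd q) : q + 1 ∈ upbSizes q := by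
  classical
  have : NeZero q := ⟨hq.pos.ne'⟩
  let e : Option (ZMod q) ≃ Fin (q + 1) := Fintype.equivFinOfCardEq (by simp)
  let _ : LinearOrder (Option (ZMod q)) := LinearOrder.lift' e e.injective
  have h := card_mem_upbSizes (ι := ZMod q) (V := Option (ZMod q)) (p := q) (by simp)
    (fun j => matchingColor (roundRobin j))
    (fun x y hxy => by
      obtain ⟨j, rfl⟩ := exists_roundRobin_eq hq hxy
      exact ⟨j, matchingColor_fst (roundRobin_roundRobin j) x,
        matchingColor_snd (roundRobin_roundRobin j) (roundRobin_ne hq j) x⟩)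
    (exists_forall_ne_of_sum_lt _ (fun _ => 1)
      (fun j l => card_filter_le_one_of_injective (matchingColor_injective (roundRobin_roundRobin j)) l)
      (by simp))
  simpa using h

/-- On two copies of the complete graph, one colouring separates the copies of each point. A round
in `M` serves a single colouring, with classes made of both copies of a point; a round outside `M`
serves two with singleton classes, for edges within and across the copies. Each round costs two in
the union bound, which totals `2 * q + 1`, but a round in `M` saves a qubit. -/
theorem doubling_mem_upbSizes {q t : ℕ} (hq : Odd q) (ht : t ≤ q) :
    2 * q + 2 ∈ upbSizes (2 * q + 1 - t) := by
  classical
  have : NeZero q := ⟨hq.pos.ne'⟩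
  obtain ⟨M, hM⟩ : ∃ M : Finset (ZMod q), M.card = t := by
    obtain ⟨M, -, hM⟩ := Finset.exists_subset_card_eq (s := (Finset.univ : Finset (ZMod q))) (n := t)
      (by simpa using ht)
    exact ⟨M, hM⟩
  let V := Option (ZMod q)
  let e : V ≃ Fin (q + 1) := Fintype.equivFinOfCardEq (by simp [V])
  let _ : LinearOrder V := LinearOrder.lift' e e.injective
  let e2 : V × Bool ≃ Fin ((q + 1) * 2) := Fintype.equivFinOfCardEq (by simp [V])
  let _ : LinearOrder (V × Bool) := LinearOrder.lift' e2 e2.injective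
  let ρ : {j : ZMod q // j ∉ M} × Bool → V × Bool → V × Bool :=
    fun j x => (roundRobin j.1.1 x.1, xor x.2 j.2)
  have hρ : ∀ j x, ρ j (ρ j x) = x := fun j x => by simp [ρ, roundRobin_roundRobin]
  have hρne : ∀ j x, ρ j x ≠ x := fun j x h => roundRobin_ne hq j.1.1 x.1 (congrArg Prod.fst h)
  let c : Unit ⊕ M ⊕ ({j : ZMod q // j ∉ M} × Bool) → V × Bool → (V ⊕ V × Bool) × Bool := fun j x =>
    match j with
    | .inl _ => (.inl x.1, x.2)
    | .inr (.inl j) => Prod.map .inl id (matchingColor (roundRobin j.1) x.1)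
    | .inr (.inr j) => Prod.map .inr id (matchingColor (ρ j) x)
  have hcM : Fintype.card {j : ZMod q // j ∉ M} = q - t := by
    rw [Fintype.card_subtype_compl, ZMod.card, Fintype.card_coe, hM]
  have h := card_mem_upbSizes (p := 2 * q + 1 - t)
    (by simp only [Fintype.card_sum, Fintype.card_unit, Fintype.card_coe, Fintype.card_prod,
          Fintype.card_bool, hM, hcM]; omega) c ?_
    (exists_forall_ne_of_sum_lt _
      (fun j => match j with | .inl _ => 1 | .inr (.inl _) => 2 | .inr (.inr _) => 1) ?_ ?_)
  · have h2 : Fintype.card (V × Bool) = 2 * q + 2 := by simp [V]; ring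
    rwa [h2] at h
  · intro x y hxy
    by_cases h1 : x.1 = y.1
    · exact ⟨.inl (), by simp [c, h1], fun h => hxy (Prod.ext h1 h)⟩
    · obtain ⟨j, hj⟩ := exists_roundRobin_eq hq h1
      by_cases hjM : j ∈ M
      · refine ⟨.inr (.inl ⟨j, hjM⟩), ?_, ?_⟩
        · simp [c, ← hj, ← matchingColor_fst (roundRobin_roundRobin j)]
        · simpa [c, ← hj] using matchingColor_snd (roundRobin_roundRobin j) (roundRobin_ne hq j) x.1
      · have hy : y = ρ (⟨j, hjM⟩, xor x.2 y.2) x := by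
          refine Prod.ext hj.symm ?_
          simp [ρ]
        refine ⟨.inr (.inr (⟨j, hjM⟩, xor x.2 y.2)), ?_, ?_⟩
        · simp only [c, Prod.map_fst, Sum.inr.injEq]
          nth_rewrite 3 [hy]
          exact matchingColor_fst (hρ _) x
        · simp only [c, Prod.map_snd, id_eq]
          nth_rewrite 3 [hy]
          exact matchingColor_snd (hρ _) (hρne _) x
  · have hinl : Function.Injective (Prod.map Sum.inl id : V × Bool → (V ⊕ V × Bool) × Bool) :=
      Sum.inl_injective.prodMap Function.injective_id
    have hinr : Function.Injective
        (Prod.map Sum.inr id : (V × Bool) × Bool → (V ⊕ V × Bool) × Bool) :=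
      Sum.inr_injective.prodMap Function.injective_id
    rintro (_ | j | j) l
    · exact card_filter_le_one_of_injective (f := c (.inl ())) hinl l
    · have hinj := hinl.comp (matchingColor_injective (roundRobin_roundRobin j.1))
      have hsub : (Finset.univ.filter fun x => c (.inr (.inl j)) x = l) ⊆
          (Finset.univ.filter fun x : V =>
            Prod.map Sum.inl id (matchingColor (roundRobin j.1) x) = l) ×ˢ Finset.univ := by
        intro x hx
        simpa [c] using hx
      refine (Finset.card_le_card hsub).trans ?_
      rw [Finset.card_product]
      have := card_filter_le_one_of_injective hinj l
      simp only [Function.comp_apply] at this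
      simp only [Finset.card_univ, Fintype.card_bool]
      omega
    · exact card_filter_le_one_of_injective (f := c (.inr (.inr j)))
        (hinr.comp (matchingColor_injective (hρ j))) l
  · simp only [Fintype.sum_sum_type, Finset.sum_const, Finset.card_univ, Fintype.card_unit,
      Fintype.card_coe, Fintype.card_prod, Fintype.card_bool, hM, hcM, smul_eq_mul]
    simp [V]
    omega

theorem add_two_mem_upbSizes {p : ℕ} (hp : p ≡ 2 [MOD 4]) : p + 2 ∈ upbSizes p := by
  have h4 : p % 4 = 2 := hp
  have h := doubling_mem_upbSizes (q := p / 2) (t := 1) (by rw [Nat.odd_iff]; omega) (by omega)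
  rwa [show 2 * (p / 2) + 2 = p + 2 by omega, show 2 * (p / 2) + 1 - 1 = p by omega] at h

theorem add_four_mem_upbSizes {p : ℕ} (hp : p ≡ 0 [MOD 4]) (hp4 : 4 ≤ p) : p + 4 ∈ upbSizes p := by
  have h4 : p % 4 = 0 := hp
  -- As `p / 2` is even, the next odd number is taken for `q`; three shared rounds then bring the
  -- number of qubits down to `p`.
  have h := doubling_mem_upbSizes (q := p / 2 + 1) (t := 3) (by rw [Nat.odd_iff]; omega) (by omega)
  rwa [show 2 * (p / 2 + 1) + 2 = p + 4 by omega, show 2 * (p / 2 + 1) + 1 - 3 = p by omega] at h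

/-! ### Verified tables for four and eight qubits -/

/-- The elements of `u` that get none of the colours `d 0, d 1, …` under the successive colourings. -/
def uncovered {V : Type*} : List ((V → ℕ) × List ℕ) → (ℕ → ℕ) → List V → List V
  | [], _, u => u
  | c :: cs, d, u => uncovered cs (fun i => d (i + 1)) (u.filter fun x => c.1 x != d 0)

/-- Whether one colour class for each colouring can cover all of `u` but `k` elements, when only the
listed colours are used by more than one element. -/
def canCover {V : Type*} : List ((V → ℕ) × List ℕ) → List V → ℕ → Bool
  | [], u, k => Nat.ble u.length k
  | c :: cs, u, k => canCover cs u (k + 1) ||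
      c.2.any fun l => canCover cs (u.filter fun x => c.1 x != l) k

theorem uncovered_sublist {V : Type*} {cs : List ((V → ℕ) × List ℕ)} {d : ℕ → ℕ} {u : List V} :
    (uncovered cs d u).Sublist u := by
  induction cs generalizing d u with
  | nil => exact List.Sublist.refl _
  | cons c cs ih => exact ih.trans List.filter_sublist

theorem mem_uncovered {V : Type*} {cs : List ((V → ℕ) × List ℕ)} {d : ℕ → ℕ} {u : List V} {x : V}
    (hx : x ∈ uncovered cs d u) (j : Fin cs.length) : (cs.get j).1 x ≠ d j := by
  induction cs generalizing d u with
  | nil => exact j.elim0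
  | cons c cs ih =>
    induction j using Fin.cases with
    | zero =>
      have : x ∈ u.filter fun x => c.1 x != d 0 := uncovered_sublist.subset hx
      simp only [List.mem_filter, bne_iff_ne] at this
      exact this.2
    | succ j => exact ih hx j

theorem uncovered_length_le_succ {V : Type*} {cs : List ((V → ℕ) × List ℕ)} {d : ℕ → ℕ}
    {u v : List V} (huv : u.Sublist v) {m : ℕ} (h : v.length ≤ u.length + m) :
    (uncovered cs d v).length ≤ (uncovered cs d u).length + m := by
  induction cs generalizing d u v with
  | nil => exact h
  | cons c cs ih =>
    refine ih (huv.filter _) ?_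
    have h1 := List.length_eq_length_filter_add (l := u) fun x => c.1 x != d 0
    have h2 := List.length_eq_length_filter_add (l := v) fun x => c.1 x != d 0
    have h3 := (huv.filter fun x => !(c.1 x != d 0)).length_le
    omega

/-- A colour outside the list removes at most one point. Instead of branching over that point, the
search keeps it and raises the allowance `k`; by `uncovered_length_le_succ` this loses no covering,
so only repeated colours need branches. -/
theorem canCover_of_uncovered {V : Type*} {cs : List ((V → ℕ) × List ℕ)} {d : ℕ → ℕ} {u : List V}
    {k : ℕ} (hu : u.Nodup) (hcs : ∀ c ∈ cs, ∀ x y, x ≠ y → c.1 x = c.1 y → c.1 x ∈ c.2)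
    (h : (uncovered cs d u).length ≤ k) : canCover cs u k = true := by
  induction cs generalizing d u k with
  | nil => simpa [canCover, uncovered] using h
  | cons c cs ih =>
    have ih' := fun {u : List V} {k : ℕ} {d} (hu : u.Nodup) =>
      ih (u := u) (k := k) (d := d) hu fun c hc => hcs c (List.mem_cons_of_mem _ hc)
    simp only [canCover, Bool.or_eq_true, List.any_eq_true]
    by_cases hd : d 0 ∈ c.2
    · exact Or.inr ⟨d 0, hd, ih' (hu.filter _) h⟩
    · refine Or.inl (ih' (d := fun i => d (i + 1)) hu ?_)
      refine (uncovered_length_le_succ List.filter_sublist (m := 1) ?_).trans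
        (Nat.add_le_add_right h 1)
      have h1 := List.length_eq_length_filter_add (l := u) fun x => c.1 x != d 0
      have h2 : (u.filter fun x => !(c.1 x != d 0)).length ≤ 1 := by
        by_contra! h3
        obtain ⟨x, y, hxy, hs⟩ : ∃ x y, x ≠ y ∧ [x, y].Sublist
            (u.filter fun x => !(c.1 x != d 0)) := by
          have hnd := hu.filter fun x => !(c.1 x != d 0)
          match hl : u.filter fun x => !(c.1 x != d 0) with
          | [] => simp [hl] at h3
          | [_] => simp [hl] at h3
          | x :: y :: t =>
            rw [hl] at hnd
            refine ⟨x, y, fun h => ?_, by simp⟩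
            simp [h] at hnd
        have hx := hs.subset (List.mem_cons_self)
        have hy := hs.subset (List.mem_cons_of_mem _ List.mem_cons_self)
        simp at hx hy
        exact hd (hx.2 ▸ hcs c List.mem_cons_self x y hxy (hx.2.trans hy.2.symm))
      omega

/-- Colours are coded by natural numbers, `2 * l` and `2 * l + 1` being complementary. -/
theorem mem_upbSizes_of_tables {n : ℕ} (cs : List ((Fin n → ℕ) × List ℕ))
    (hcs : ∀ c ∈ cs, ∀ x y, x ≠ y → c.1 x = c.1 y → c.1 x ∈ c.2)
    (horth : ∀ x y : Fin n, x < y → ∃ c ∈ cs, c.1 x / 2 = c.1 y / 2 ∧ c.1 x ≠ c.1 y)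
    (hunext : canCover cs (List.finRange n) 0 = false) : n ∈ upbSizes cs.length := by
  have hparity : ∀ a b : ℕ, a / 2 = b / 2 → decide (a % 2 = 1) = decide (b % 2 = 1) → a = b := by
    intro a b h1 h2
    rw [decide_eq_decide] at h2
    omega
  have horth' : ∀ x y : Fin n, x ≠ y → ∃ c ∈ cs, c.1 x / 2 = c.1 y / 2 ∧ c.1 x ≠ c.1 y := by
    intro x y hxy
    rcases lt_or_gt_of_ne hxy with h | h
    · exact horth x y h
    · obtain ⟨c, hc, h1, h2⟩ := horth y x h
      exact ⟨c, hc, h1.symm, h2.symm⟩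
  have h := card_mem_upbSizes (ι := Fin cs.length) (V := Fin n) (p := cs.length) (by simp)
    (fun j x => ((cs.get j).1 x / 2, decide ((cs.get j).1 x % 2 = 1))) ?_ ?_
  · simpa using h
  · intro x y hxy
    obtain ⟨c, hc, h1, h2⟩ := horth' x y hxy
    obtain ⟨j, rfl⟩ := List.get_of_mem hc
    exact ⟨j, h1, fun h => h2 (hparity _ _ h1 h)⟩
  · intro d
    let d' : ℕ → ℕ := fun i => if h : i < cs.length then
      2 * (d ⟨i, h⟩).1 + (if (d ⟨i, h⟩).2 then 1 else 0) else 0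
    have hpos : uncovered cs d' (List.finRange n) ≠ [] := fun h => by
      have := canCover_of_uncovered (k := 0) (d := d') (List.nodup_finRange n) hcs (by simp [h])
      simp [this] at hunext
    obtain ⟨x, hx⟩ := List.exists_mem_of_ne_nil _ hpos
    refine ⟨x, fun j hj => mem_uncovered hx j ?_⟩
    simp only [d', j.2, dif_pos, Fin.eta, ← hj, decide_eq_true_eq]
    split_ifs <;> omega

/-- An unextendible product basis of six states of four qubits. -/
def sixStates : List ((Fin 6 → ℕ) × List ℕ) :=
  [(![0, 2, 3, 4, 5, 1], []), (![0, 2, 1, 3, 1, 3], [1, 3]), (![0, 2, 4, 1, 3, 5], []),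
    (![0, 1, 2, 3, 3, 2], [2, 3])]

/-- An unextendible product basis of eleven states of eight qubits. -/
def elevenStates : List ((Fin 11 → ℕ) × List ℕ) :=
  [(![0, 2, 3, 1, 4, 0, 6, 2, 7, 5, 1], [0, 1, 2]), (![0, 0, 2, 4, 6, 4, 7, 6, 5, 1, 3], [0, 4, 6]),
    (![0, 2, 4, 5, 3, 5, 6, 8, 1, 9, 7], [5]), (![0, 2, 4, 0, 6, 3, 1, 2, 7, 5, 3], [0, 2, 3]),
    (![0, 2, 4, 6, 5, 1, 8, 2, 3, 9, 7], [2]), (![0, 1, 2, 4, 1, 4, 3, 0, 6, 5, 7], [0, 1, 4]),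
    (![0, 2, 4, 6, 7, 6, 3, 1, 5, 8, 9], [6]), (![0, 2, 1, 3, 4, 6, 7, 2, 8, 9, 5], [2])]

theorem six_mem_upbSizes : 6 ∈ upbSizes 4 :=
  mem_upbSizes_of_tables sixStates (by decide +kernel) (by decide +kernel) (by decide +kernel)

theorem eleven_mem_upbSizes : 11 ∈ upbSizes 8 :=
  mem_upbSizes_of_tables elevenStates (by decide +kernel) (by decide +kernel) (by decide +kernel)

/-! ### Rainbow-free matchings: finding a shared edge -/

/-- Matchings without a rainbow matching of size three: `m i` is the involution whose non-trivial
orbits are the edges of the `i`-th matching, and no three pairwise disjoint edges belong to three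
different matchings. -/
structure IsRainbowFree {I V : Type*} (m : I → V → V) : Prop where
  invol : ∀ i x, m i (m i x) = x
  three : ∀ i, ∃ a b c, m i a ≠ a ∧ m i b ≠ b ∧ m i c ≠ c ∧ a ≠ b ∧ a ≠ c ∧ b ≠ c ∧
    m i a ≠ b ∧ m i a ≠ c ∧ m i b ≠ c
  meet : ∀ i j k, i ≠ j → i ≠ k → j ≠ k → ∀ x y z, m i x ≠ x → m j y ≠ y → m k z ≠ z →
    (x = y ∨ x = m j y ∨ m i x = y ∨ m i x = m j y) ∨
    (x = z ∨ x = m k z ∨ m i x = z ∨ m i x = m k z) ∨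
    (y = z ∨ y = m k z ∨ m j y = z ∨ m j y = m k z)

namespace IsRainbowFree

variable {I V : Type*} {m : I → V → V}

/-- Each of the two points lies on at most one of three disjoint edges. -/
theorem exists_edge (h : IsRainbowFree m) (i : I) (x y : V) :
    ∃ z, m i z ≠ z ∧ z ≠ x ∧ z ≠ y ∧ m i z ≠ x ∧ m i z ≠ y := by
  obtain ⟨a, b, c, h1⟩ := h.three i
  have ha := h.invol i a
  have hb := h.invol i b
  have hc := h.invol i c
  by_contra hcon
  have key : ∀ z, m i z ≠ z → z = x ∨ z = y ∨ m i z = x ∨ m i z = y := fun z hz => by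
    by_contra! h2
    exact hcon ⟨z, hz, h2⟩
  have ha' := key a h1.1
  have hb' := key b h1.2.1
  have hc' := key c h1.2.2.1
  clear key hcon h
  grind

theorem exists_two_edges (h : IsRainbowFree m) (i : I) (x : V) :
    ∃ y z, m i y ≠ y ∧ m i z ≠ z ∧ y ≠ z ∧ m i y ≠ z ∧ y ≠ x ∧ m i y ≠ x ∧ z ≠ x ∧ m i z ≠ x := by
  obtain ⟨a, b, c, h1⟩ := h.three i
  have ha := h.invol i a
  have hb := h.invol i b
  have hc := h.invol i c
  by_cases h2 : a = x ∨ m i a = x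
  · exact ⟨b, c, by grind⟩
  · by_cases h3 : b = x ∨ m i b = x
    · exact ⟨a, c, by grind⟩
    · exact ⟨a, b, by grind⟩

/-- Three pairwise meeting edges, each joining `{p, p'}` to `{q, q'}`, are not all different. -/
theorem eq_of_transversal {p p' q q' : V} {s t : Fin 3 → V}
    (hs : ∀ i, s i = p ∨ s i = p') (ht : ∀ i, t i = q ∨ t i = q')
    (hmeet : ∀ i j, i ≠ j → s i = s j ∨ t i = t j) : ∃ i j, i ≠ j ∧ s i = s j ∧ t i = t j := by
  -- These edges lie in a four-cycle, where at most two different edges meet pairwise.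
  by_contra! hcon
  have h01 := hcon 0 1 (by decide)
  have h02 := hcon 0 2 (by decide)
  have h12 := hcon 1 2 (by decide)
  have k01 := hmeet 0 1 (by decide)
  have k02 := hmeet 0 2 (by decide)
  have k12 := hmeet 1 2 (by decide)
  have s0 := hs 0
  have s1 := hs 1
  have s2 := hs 2
  have t0 := ht 0
  have t1 := ht 1
  have t2 := ht 2
  grind

/-- An edge of `m k` off the edge at `x` must meet the edges at `y` and `y'`, which are also off the
edge at `x`. These being disjoint, it joins them. -/
theorem exists_transversal (h : IsRainbowFree m) {i j k : I} (hij : i ≠ j) (hik : i ≠ k)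
    (hjk : j ≠ k) {x y y' : V} (hx : m i x ≠ x) (hy : m j y ≠ y) (hy' : m j y' ≠ y')
    (hyy : y ≠ y') (hyy' : m j y ≠ y')
    (hxy : y ≠ x ∧ m j y ≠ x ∧ y ≠ m i x ∧ m j y ≠ m i x)
    (hxy' : y' ≠ x ∧ m j y' ≠ x ∧ y' ≠ m i x ∧ m j y' ≠ m i x) :
    ∃ z, (z = y ∨ z = m j y) ∧ (m k z = y' ∨ m k z = m j y') ∧ z ≠ x ∧ z ≠ m i x ∧ m k z ≠ x ∧
      m k z ≠ m i x ∧ m k z ≠ z := by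
  obtain ⟨z, hz, h1, h2, h3, h4⟩ := h.exists_edge k x (m i x)
  have e1 := h.meet i j k hij hik hjk x y z hx hy hz
  have e2 := h.meet i j k hij hik hjk x y' z hx hy' hz
  have i1 := h.invol j y
  have i2 := h.invol j y'
  have i3 := h.invol k z
  by_cases hc : z = y ∨ z = m j y
  · exact ⟨z, hc, by grind⟩
  · exact ⟨m k z, by grind⟩

theorem meet_of_avoid (h : IsRainbowFree m) {i j k : I} (hij : i ≠ j) (hik : i ≠ k)
    (hjk : j ≠ k) {x y z : V} (hx : m i x ≠ x) (hy : m j y ≠ y) (hz : m k z ≠ z)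
    (hxy : x ≠ y ∧ x ≠ m j y ∧ m i x ≠ y ∧ m i x ≠ m j y)
    (hxz : x ≠ z ∧ x ≠ m k z ∧ m i x ≠ z ∧ m i x ≠ m k z) :
    y = z ∨ y = m k z ∨ m j y = z ∨ m j y = m k z := by
  have := h.meet i j k hij hik hjk x y z hx hy hz
  tauto

/-- If two edges of one matching avoid an edge of another, then two of the other three matchings
share an edge that avoids it as well. -/
theorem exists_shared_of_two (h : IsRainbowFree m) {i j : I} {k : Fin 3 → I} (hij : i ≠ j)
    (hik : ∀ l, i ≠ k l) (hjk : ∀ l, j ≠ k l) (hk : Function.Injective k)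
    {x y y' : V} (hx : m i x ≠ x) (hy : m j y ≠ y) (hy' : m j y' ≠ y')
    (hyy : y ≠ y') (hyy' : m j y ≠ y')
    (hxy : y ≠ x ∧ m j y ≠ x ∧ y ≠ m i x ∧ m j y ≠ m i x)
    (hxy' : y' ≠ x ∧ m j y' ≠ x ∧ y' ≠ m i x ∧ m j y' ≠ m i x) :
    ∃ l l', l ≠ l' ∧ ∃ z, m (k l) z = m (k l') z ∧ m (k l) z ≠ z ∧ z ≠ x ∧ z ≠ m i x ∧
      m (k l) z ≠ x ∧ m (k l) z ≠ m i x := by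
  choose z hz using fun l => h.exists_transversal hij (hik l) (hjk l) hx hy hy' hyy hyy' hxy hxy'
  have hyyy : y ≠ m j y' := fun h' => hyy' (by rw [h', h.invol])
  have hyyyy : m j y ≠ m j y' := fun h' => hyy (by rw [← h.invol j y, h', h.invol])
  -- The three transversal edges are disjoint from the edge at `x`, hence meet pairwise.
  obtain ⟨l, l', hll, e1, e2⟩ := eq_of_transversal (s := z) (t := fun l => m (k l) (z l))
    (fun l => (hz l).1) (fun l => (hz l).2.1) (fun l l' hll => by
      have h1 := hz l
      have h2 := hz l'
      have := h.meet_of_avoid (hik l) (hik l') (fun e => hll (hk e)) hx h1.2.2.2.2.2.2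
        h2.2.2.2.2.2.2 ⟨h1.2.2.1.symm, h1.2.2.2.2.1.symm, h1.2.2.2.1.symm, h1.2.2.2.2.2.1.symm⟩
        ⟨h2.2.2.1.symm, h2.2.2.2.2.1.symm, h2.2.2.2.1.symm, h2.2.2.2.2.2.1.symm⟩
      obtain ⟨p1, p2, -⟩ := h1
      obtain ⟨q1, q2, -⟩ := h2
      rcases this with e | e | e | e
      · exact Or.inl e
      · grind
      · grind
      · exact Or.inr e)
  refine ⟨l, l', hll, z l, ?_, ?_⟩
  · exact e2.trans (by rw [e1])
  · have := (hz l).2.2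
    exact ⟨this.2.2.2.2, this.1, this.2.1, this.2.2.1, this.2.2.2.1⟩

theorem exists_three_others : ∀ i j : Fin 5, i ≠ j → ∃ k : Fin 3 → Fin 5,
    Function.Injective k ∧ (∀ l, i ≠ k l) ∧ ∀ l, j ≠ k l := by
  decide +kernel

/-- Without a shared edge, `exists_shared_of_two` forbids an edge of one matching to be disjoint
from two edges of another. Given three edges of `m 0`, at `a`, `b` and `c`, an edge of another
matching off the one at `a` therefore joins the other two. Three such edges from three matchings
meet pairwise, so two coincide. -/
theorem exists_shared (m : Fin 5 → V → V) (h : IsRainbowFree m) :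
    ∃ i j x, i ≠ j ∧ m i x ≠ x ∧ m j x = m i x := by
  by_contra! hcon
  have key : ∀ i j : Fin 5, i ≠ j → ∀ x y y', m i x ≠ x → m j y ≠ y → m j y' ≠ y' →
      y ≠ y' → m j y ≠ y' →
      (y ≠ x ∧ m j y ≠ x ∧ y ≠ m i x ∧ m j y ≠ m i x) →
      (y' ≠ x ∧ m j y' ≠ x ∧ y' ≠ m i x ∧ m j y' ≠ m i x) → False := by
    intro i j hij x y y' hx hy hy' h1 h2 h3 h4
    obtain ⟨k, hk, hki, hkj⟩ : ∃ k : Fin 3 → Fin 5, Function.Injective k ∧ (∀ l, i ≠ k l) ∧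
        ∀ l, j ≠ k l := by
      exact exists_three_others i j hij
    obtain ⟨l, l', hll, z, e1, e2, -⟩ := h.exists_shared_of_two hij hki hkj hk hx hy hy' h1 h2 h3 h4
    exact hcon (k l) (k l') z (fun e => hll (hk e)) e2 e1.symm
  obtain ⟨a, -, -, ha, -⟩ := h.three 0
  obtain ⟨b, c, hb, hc, hbc, hbc', hba, hba', hca, hca'⟩ := h.exists_two_edges 0 a
  have iv := h.invol 0
  -- `l.succ.castSucc` runs through `1`, `2`, `3`.
  choose z hz hz1 hz2 hz3 hz4 using fun l : Fin 3 => h.exists_edge l.succ.castSucc a (m 0 a)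
  have hb0 : m 0 b ≠ m 0 a := fun e => hba (by rw [← iv b, e, iv])
  have hc0 : m 0 c ≠ m 0 a := fun e => hca (by rw [← iv c, e, iv])
  have hb1 : b ≠ m 0 a := fun e => hba' (by rw [e, iv])
  have hc1 : c ≠ m 0 a := fun e => hca' (by rw [e, iv])
  have hbc1 : b ≠ m 0 c := fun e => hbc' (by rw [e, iv])
  have hbc2 : m 0 b ≠ m 0 c := fun e => hbc (by rw [← iv b, e, iv])
  have hl : ∀ l : Fin 3, l.succ.castSucc ≠ (0 : Fin 5) := by decide
  have kb := fun l => key l.succ.castSucc 0 (hl l) (z l) a b (hz l) ha hb hba.symm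
    (fun e => hb1 e.symm) (by grind)
  have kc := fun l => key l.succ.castSucc 0 (hl l) (z l) a c (hz l) ha hc hca.symm
    (fun e => hc1 e.symm) (by grind)
  have htr : ∀ l, ∃ w, (w = b ∨ w = m 0 b) ∧
      (m l.succ.castSucc w = c ∨ m l.succ.castSucc w = m 0 c) ∧
      (w = z l ∨ w = m l.succ.castSucc (z l)) := fun l => by
    have iz := h.invol l.succ.castSucc (z l)
    have kb := kb l
    have kc := kc l
    by_cases hcz : z l = b ∨ z l = m 0 b
    · exact ⟨z l, by grind⟩
    · exact ⟨m l.succ.castSucc (z l), by grind⟩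
  choose w hw1 hw2 hw3 using htr
  have hwe : ∀ l, m l.succ.castSucc (w l) ≠ w l := fun l => by
    have iz := h.invol l.succ.castSucc (z l)
    have := hz l
    rcases hw3 l with e | e <;> rw [e] <;> grind
  have hne : ∀ l l' : Fin 3, l ≠ l' → l.succ.castSucc ≠ l'.succ.castSucc := by decide
  obtain ⟨l, l', hll, e1, e2⟩ := eq_of_transversal (s := w) (t := fun l => m l.succ.castSucc (w l)) hw1 hw2
    (fun l l' hll => by
      have h1 := hw1 l
      have h2 := hw1 l'
      have h3 := hw2 l
      have h4 := hw2 l'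
      have := h.meet_of_avoid (hl l).symm (hl l').symm (hne l l' hll) ha (hwe l) (hwe l')
        (by grind) (by grind)
      rcases this with e | e | e | e
      · exact Or.inl e
      · grind
      · grind
      · exact Or.inr e)
  exact hcon _ _ (w l) (hne l l' hll) (hwe l) (by
    have e3 : m _ (w l) = m _ (w l') := e2
    rw [e1] at e3 ⊢
    exact e3.symm)

end IsRainbowFree

/-! ### Two shared edges and the fifth matching -/

namespace IsRainbowFree

variable {I V : Type*} {m : I → V → V}

/-- An edge `ab` shared by two matchings forces both ends of a disjoint edge of a third matching to
be covered by different edges of either of the two. -/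
theorem covered_of_shared (h : IsRainbowFree m) {i j k : I} (hij : i ≠ j) (hik : i ≠ k)
    (hjk : j ≠ k) {a u : V} (ha : m i a ≠ a) (haj : m j a = m i a) (hu : m k u ≠ u)
    (h1 : a ≠ u) (h2 : a ≠ m k u) (h3 : m i a ≠ u) (h4 : m i a ≠ m k u) :
    m i u ≠ u ∧ m i (m k u) ≠ m k u ∧ m i u ≠ m k u := by
  obtain ⟨y, z, hy, hz, hyz, hyz', hya, hya', hza, hza'⟩ := h.exists_two_edges i a
  have ia := h.invol i a
  have iy := h.invol i y
  have iz := h.invol i z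
  -- With the shared edge charged to `j`, every other edge of `m i` must meet the edge at `u`. Two
  -- such edges, being disjoint, cover its ends separately.
  have key : ∀ y, m i y ≠ y → y ≠ a → m i y ≠ a →
      y = u ∨ y = m k u ∨ m i y = u ∨ m i y = m k u := fun y hy hya hya' => by
    have iy := h.invol i y
    refine h.meet_of_avoid hij.symm hjk hik (haj ▸ ha : m j a ≠ a) hy hu ?_ ?_
    · refine ⟨hya.symm, hya'.symm, ?_, ?_⟩ <;> rw [haj]
      · intro e; exact hya' (by rw [← e, ia])
      · intro e; exact hya (by rw [← iy, ← e, ia])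
    · rw [haj]; exact ⟨h1, h2, h3, h4⟩
  have ky := key y hy hya hya'
  have kz := key z hz hza hza'
  clear key
  grind

/-- Four matchings, of which two share the edge `ab` and the other two the edge `uv`. -/
structure IsTwoShared (m : I → V → V) (i j k l q : I) (a b u v s s' w w' d d' c c' : V) : Prop where
  free : IsRainbowFree m
  ij : i ≠ j
  ik : i ≠ k
  il : i ≠ l
  iq : i ≠ q
  jk : j ≠ k
  jl : j ≠ l
  jq : j ≠ q
  kl : k ≠ l
  kq : k ≠ q
  lq : l ≠ q
  ia : m i a = b
  ja : m j a = b
  ku : m k u = v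
  lu : m l u = v
  iu : m i u = s
  iv : m i v = s'
  ju : m j u = w
  jv : m j v = w'
  ka : m k a = d
  kb : m k b = d'
  la : m l a = c
  lb : m l b = c'
  ab : a ≠ b
  uv : u ≠ v
  au : a ≠ u
  av : a ≠ v
  bu : b ≠ u
  bv : b ≠ v
  su : s ≠ u
  sv : s ≠ v
  tv : s' ≠ v
  wu : w ≠ u
  wv : w ≠ v
  xv : w' ≠ v
  da : d ≠ a
  db : d ≠ b
  eb : d' ≠ b
  ca : c ≠ a
  cb : c ≠ b
  fb : c' ≠ b

namespace IsTwoShared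

variable {i j k l q : I} {a b u v s s' w w' d d' c c' : V}

/-- The configuration is symmetric under exchanging the two shared edges, the ends of each, and the
two matchings through each. The swaps let one case stand for all its images. -/
theorem swap_sides (h : IsTwoShared m i j k l q a b u v s s' w w' d d' c c') :
    IsTwoShared m k l i j q u v a b d d' c c' s s' w w' where
  free := h.free
  ij := h.kl
  ik := h.ik.symm
  il := h.jk.symm
  iq := h.kq
  jk := h.il.symm
  jl := h.jl.symm
  jq := h.lq
  kl := h.ij
  kq := h.iq
  lq := h.jq
  ia := h.ku
  ja := h.lu
  ku := h.ia
  lu := h.ja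
  iu := h.ka
  iv := h.kb
  ju := h.la
  jv := h.lb
  ka := h.iu
  kb := h.iv
  la := h.ju
  lb := h.jv
  ab := h.uv
  uv := h.ab
  au := h.au.symm
  av := h.bu.symm
  bu := h.av.symm
  bv := h.bv.symm
  su := h.da
  sv := h.db
  tv := h.eb
  wu := h.ca
  wv := h.cb
  xv := h.fb
  da := h.su
  db := h.sv
  eb := h.tv
  ca := h.wu
  cb := h.wv
  fb := h.xv

theorem swap_ends (h : IsTwoShared m i j k l q a b u v s s' w w' d d' c c') :
    IsTwoShared m i j k l q a b v u s' s w' w d d' c c' where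
  __ := h
  ku := by rw [← h.ku, h.free.invol]
  lu := by rw [← h.lu, h.free.invol]
  iu := h.iv
  iv := h.iu
  ju := h.jv
  jv := h.ju
  uv := h.uv.symm
  au := h.av
  av := h.au
  bu := h.bv
  bv := h.bu
  su := h.tv
  sv := fun e => h.sv (by rw [← h.iu, ← e, ← h.iv, h.free.invol])
  tv := h.su
  wu := h.xv
  wv := fun e => h.wv (by rw [← h.ju, ← e, ← h.jv, h.free.invol])
  xv := h.wu

theorem swap_ends' (h : IsTwoShared m i j k l q a b u v s s' w w' d d' c c') :
    IsTwoShared m i j k l q b a u v s s' w w' d' d c' c :=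
  h.swap_sides.swap_ends.swap_sides

/-- The elements `s, s', w, w'` differ from `a, b, u, v`. -/
theorem fresh (h : IsTwoShared m i j k l q a b u v s s' w w' d d' c c') :
    s ≠ a ∧ s ≠ b ∧ s' ≠ a ∧ s' ≠ b ∧ s' ≠ u ∧ s ≠ s' ∧ w ≠ a ∧ w ≠ b ∧ w' ≠ a ∧ w' ≠ b ∧ w' ≠ u ∧
      w ≠ w' := by
  have h1 := h.free.invol i a
  have h2 := h.free.invol i u
  have h3 := h.free.invol i v
  have h4 := h.free.invol j a
  have h5 := h.free.invol j u
  have h6 := h.free.invol j v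
  rw [h.ia] at h1
  rw [h.iu] at h2
  rw [h.iv] at h3
  rw [h.ja] at h4
  rw [h.ju] at h5
  rw [h.jv] at h6
  have ha := h.ia
  have hb := h.ja
  have g1 := h.iu
  have g2 := h.iv
  have g3 := h.ju
  have g4 := h.jv
  have e1 := h.au
  have e2 := h.av
  have e3 := h.bu
  have e4 := h.bv
  have e5 := h.sv
  have e6 := h.wv
  have e7 := h.uv
  clear h
  refine ⟨?_, ?_, ?_, ?_, ?_, ?_, ?_, ?_, ?_, ?_, ?_, ?_⟩ <;> grind

theorem mem_of_fifth (h : IsTwoShared m i j k l q a b u v s s' w w' d d' c c') {z : V}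
    (hz : m q z ≠ z) : (a = z ∨ a = m q z ∨ b = z ∨ b = m q z) ∨
      (u = z ∨ u = m q z ∨ v = z ∨ v = m q z) := by
  have h1 := h.free.meet i k q h.ik h.iq h.kq a u z (by rw [h.ia]; exact h.ab.symm)
    (by rw [h.ku]; exact h.uv.symm) hz
  have e1 := h.au
  have e2 := h.av
  have e3 := h.bu
  have e4 := h.bv
  rw [h.ia, h.ku] at h1
  tauto

/-- The fifth matching covers `u` by `uv`, by an edge to `{a, b}`, or by `us'` where `s' = w'`. -/
theorem fifth_at (h : IsTwoShared m i j k l q a b u v s s' w w' d d' c c') (hq : m q u ≠ u)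
    (hqa : m q u ≠ a) (hqb : m q u ≠ b) : m q u = v ∨ (m q u = s' ∧ m q u = w') := by
  -- With `ab` charged to `j` and then to `i`, an edge of `q` off `ab` must meet both `vs'` and
  -- `vw'`.
  have h1 := h.free.meet j i q h.ij.symm h.jq h.iq a v u (by rw [h.ja]; exact h.ab.symm)
    (by rw [h.iv]; exact h.tv) hq
  have h2 := h.free.meet i j q h.ij h.iq h.jq a v u (by rw [h.ia]; exact h.ab.symm)
    (by rw [h.jv]; exact h.xv) hq
  have f := h.fresh
  rw [h.ja, h.iv] at h1
  rw [h.ia, h.jv] at h2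
  have e1 := h.au
  have e2 := h.av
  have e3 := h.bu
  have e4 := h.bv
  have e5 := h.uv
  clear h
  grind

/-- Among the edges `au` of `q`, `vs'` of `i` and `bd'` of `k`, only the ends `s'` and `d'` can
agree. -/
theorem eq_of_fifth_cross (h : IsTwoShared m i j k l q a b u v s s' w w' d d' c c')
    (hq : m q a = u) : s' = d' := by
  have h1 := h.free.meet i k q h.ik h.iq h.kq v b a (by rw [h.iv]; exact h.tv)
    (by rw [h.kb]; exact h.eb) (by rw [hq]; exact h.au.symm)
  rw [h.iv, h.kb, hq] at h1
  have f := h.fresh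
  have f' := h.swap_sides.fresh
  have e1 := h.au
  have e2 := h.av
  have e3 := h.bu
  have e4 := h.bv
  have e5 := h.uv
  have e6 := h.ab
  clear h
  grind

theorem swap_last (h : IsTwoShared m i j k l q a b u v s s' w w' d d' c c') :
    IsTwoShared m i j l k q a b u v s s' w w' c c' d d' where
  __ := h
  ik := h.il
  il := h.ik
  jk := h.jl
  jl := h.jk
  kl := h.kl.symm
  kq := h.lq
  lq := h.kq
  ku := h.lu
  lu := h.ku
  ka := h.la
  kb := h.lb
  la := h.ka
  lb := h.kb
  da := h.ca
  db := h.cb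
  eb := h.fb
  ca := h.da
  cb := h.db
  fb := h.eb

theorem swap_first (h : IsTwoShared m i j k l q a b u v s s' w w' d d' c c') :
    IsTwoShared m j i k l q a b u v w w' s s' d d' c c' :=
  h.swap_sides.swap_last.swap_sides

/-- The edges `us` and `vw'` are disjoint only if `{s, w'} = {d, d'}`. -/
theorem eq_or_eq (h : IsTwoShared m i j k l q a b u v s s' w w' d d' c c') :
    s = w' ∨ (s = d ∧ w' = d') ∨ (s = d' ∧ w' = d) := by
  have h1 := h.free.meet i j k h.ij h.ik h.jk u v a (by rw [h.iu]; exact h.su)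
    (by rw [h.jv]; exact h.xv) (by rw [h.ka]; exact h.da)
  have h2 := h.free.meet i j k h.ij h.ik h.jk u v b (by rw [h.iu]; exact h.su)
    (by rw [h.jv]; exact h.xv) (by rw [h.kb]; exact h.eb)
  rw [h.iu, h.jv, h.ka] at h1
  rw [h.iu, h.jv, h.kb] at h2
  have f := h.fresh
  have f' := h.swap_sides.fresh
  have e1 := h.au
  have e2 := h.av
  have e3 := h.bu
  have e4 := h.bv
  have e5 := h.uv
  have e6 := h.sv
  clear h
  grind

/-- If `q` contained `au`, the swaps would give `s' = w' = d' = c'` and then `s = w = d = c`. Two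
further edges of `q` must cover `b` and `v` separately, and by `fifth_at` they end at `d` and `s`,
the same point. -/
theorem not_fifth_cross (h : IsTwoShared m i j k l q a b u v s s' w w' d d' c c') :
    m q a ≠ u := by
  intro hq
  have hq' : m q u = a := by rw [← hq, h.free.invol]
  have h1 := h.eq_of_fifth_cross hq
  have h2 := h.swap_first.eq_of_fifth_cross hq
  have h3 := h.swap_last.eq_of_fifth_cross hq
  have h4 := h.eq_or_eq
  have h4' := h.swap_first.eq_or_eq
  have h5 := h.swap_last.eq_or_eq
  have f := h.fresh
  have f' := h.swap_sides.fresh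
  have hsd : s = d ∧ s = c ∧ s = w := by
    clear h
    grind
  obtain ⟨y, z, hy, hz, hyz, hyz', hyu, hyu', hzu, hzu'⟩ := h.free.exists_two_edges q u
  have iy := h.free.invol q y
  have iz := h.free.invol q z
  have ib := h.free.invol q b
  have iv := h.free.invol q v
  have my := h.mem_of_fifth hy
  have mz := h.mem_of_fifth hz
  have k1 := h.swap_ends.fifth_at
  have k2 := h.swap_sides.swap_ends.fifth_at
  have e1 := h.bv
  clear h
  have hy1 : y = b ∨ y = v ∨ m q y = b ∨ m q y = v := by grind
  have hz1 : z = b ∨ z = v ∨ m q z = b ∨ m q z = v := by grind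
  clear my mz
  have hb : m q b ≠ b ∧ m q b ≠ v ∧ m q v ≠ v := by grind
  have := k1 hb.2.2 (by grind) (by grind)
  have := k2 hb.1 (by grind) (by grind)
  grind

/-- The edge of `q` at `a` is `ab`, or it ends at `d' = c'`. In the first case `ab`, `us`, `vw'` are
disjoint; in the second `eq_or_eq` makes it end at a point that `q` already joins to `u` or `v`. -/
theorem not_fifth_two (h : IsTwoShared m i j k l q a b u v s s' w w' d d' c c')
    (hqu : m q u = s') (hqu' : m q u = w') (hqv : m q v = s)
    (ha : m q a ≠ a) : False := by
  have iu := h.free.invol q u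
  have iv := h.free.invol q v
  have ia := h.free.invol q a
  have f := h.fresh
  have f' := h.swap_sides.fresh
  have k1 := h.swap_sides.fifth_at ha h.not_fifth_cross h.swap_ends.not_fifth_cross
  have h3 := h.swap_sides.eq_or_eq
  have e1 := h.au
  have e2 := h.av
  by_cases hab : m q a = b
  · have h1 := h.free.meet q i j h.iq.symm h.jq.symm h.ij a u v ha
      (by rw [h.iu]; exact h.su) (by rw [h.jv]; exact h.xv)
    rw [hab, h.iu, h.jv] at h1
    have e3 := h.bu
    have e4 := h.bv
    have e5 := h.uv
    have e6 := h.sv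
    clear h
    grind
  · clear h
    grind

/-- Every edge of `q` meets `ab` or `uv`, and none joins the two. If `q` covers both ends of one
shared edge separately, it avoids the other, so it has at most two edges. -/
theorem elim (h : IsTwoShared m i j k l q a b u v s s' w w' d d' c c') : False := by
  obtain ⟨x, y, z, hx, hy, hz, hxy, hxz, hyz, hxy', hxz', hyz'⟩ := h.free.three q
  have mx := h.mem_of_fifth hx
  have my := h.mem_of_fifth hy
  have mz := h.mem_of_fifth hz
  have c1 := h.not_fifth_cross
  have c2 := h.swap_ends.not_fifth_cross
  have c3 := h.swap_ends'.not_fifth_cross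
  have c4 := h.swap_ends'.swap_ends.not_fifth_cross
  have ka : m q a = a ∨ m q a = b ∨ (m q a = d' ∧ m q a = c') := by
    by_cases e : m q a = a
    · exact Or.inl e
    · exact Or.inr (h.swap_sides.fifth_at e c1 c2)
  have kb : m q b = b ∨ m q b = a ∨ (m q b = d ∧ m q b = c) := by
    by_cases e : m q b = b
    · exact Or.inl e
    · exact Or.inr (h.swap_sides.swap_ends.fifth_at e c3 c4)
  have ku : m q u = u ∨ m q u = v ∨ (m q u = s' ∧ m q u = w') := by
    by_cases e : m q u = u
    · exact Or.inl e
    · refine Or.inr (h.fifth_at e (fun e => c1 ?_) (fun e => c3 ?_)) <;> rw [← e, h.free.invol]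
  have kv : m q v = v ∨ m q v = u ∨ (m q v = s ∧ m q v = w) := by
    by_cases e : m q v = v
    · exact Or.inl e
    · refine Or.inr (h.swap_ends.fifth_at e (fun e => c2 ?_) (fun e => c4 ?_)) <;>
        rw [← e, h.free.invol]
  have n1 := h.not_fifth_two
  have n2 := h.swap_ends'.not_fifth_two
  have n3 := h.swap_sides.not_fifth_two
  have n4 := h.swap_sides.swap_ends'.not_fifth_two
  have ix := h.free.invol q x
  have iy := h.free.invol q y
  have iz := h.free.invol q z
  have ia := h.free.invol q a
  have ib := h.free.invol q b
  have iu := h.free.invol q u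
  have iv := h.free.invol q v
  clear h
  have key1 : m q a ≠ a → m q b ≠ b → m q a ≠ b → m q u = u ∧ m q v = v := by
    clear mx my mz c1 c2 c3 c4 n1 n2
    grind
  have key2 : m q u ≠ u → m q v ≠ v → m q u ≠ v → m q a = a ∧ m q b = b := by
    clear mx my mz c1 c2 c3 c4 n3 n4
    grind
  clear c1 c2 c3 c4 n1 n2 n3 n4 ka kb ku kv
  rcases mx with mx | mx <;> rcases my with my | my <;> rcases mz with mz | mz <;> grind

end IsTwoShared

theorem false_of_two_shared (h : IsRainbowFree m) {i j k l q : I} (ij : i ≠ j) (ik : i ≠ k)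
    (il : i ≠ l) (iq : i ≠ q) (jk : j ≠ k) (jl : j ≠ l) (jq : j ≠ q) (kl : k ≠ l) (kq : k ≠ q)
    (lq : l ≠ q) {a u : V} (ha : m i a ≠ a) (haj : m j a = m i a) (hu : m k u ≠ u)
    (hul : m l u = m k u) (h1 : a ≠ u) (h2 : a ≠ m k u) (h3 : m i a ≠ u) (h4 : m i a ≠ m k u) :
    False := by
  obtain ⟨i1, i2, i3⟩ := h.covered_of_shared ij ik jk ha haj hu h1 h2 h3 h4
  obtain ⟨j1, j2, j3⟩ := h.covered_of_shared ij.symm jk ik (haj ▸ ha) haj.symm hu h1 h2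
    (haj ▸ h3) (haj ▸ h4)
  obtain ⟨k1, k2, k3⟩ := h.covered_of_shared kl ik.symm il.symm hu hul ha h1.symm h3.symm h2.symm
    h4.symm
  obtain ⟨l1, l2, l3⟩ := h.covered_of_shared kl.symm il.symm ik.symm (hul ▸ hu) hul.symm ha
    h1.symm h3.symm (hul ▸ h2.symm) (hul ▸ h4.symm)
  exact IsTwoShared.elim (q := q) (i := i) (j := j) (k := k) (l := l) (m := m)
    ⟨h, ij, ik, il, iq, jk, jl, jq, kl, kq, lq, rfl, haj, rfl, hul, rfl, rfl, rfl, rfl, rfl, rfl,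
      rfl, rfl, ha.symm, hu.symm, h1, h2, h3, h4, i1, i3, i2, j1, j3, j2, k1, k3, k2, l1, l3, l2⟩

theorem exists_fifth : ∀ i j : Fin 5, ∀ k : Fin 3 → Fin 5, Function.Injective k → (∀ l, i ≠ k l) →
    (∀ l, j ≠ k l) → ∀ l l', l ≠ l' → ∃ q, i ≠ q ∧ j ≠ q ∧ k l ≠ q ∧ k l' ≠ q := by
  intro i j k hk hi hj l l' hll
  obtain ⟨l'', h1, h2⟩ : ∃ l'', l ≠ l'' ∧ l' ≠ l'' := by revert l l'; decide
  exact ⟨k l'', hi _, hj _, hk.ne h1, hk.ne h2⟩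

/-- Among five matchings of size three there is a rainbow matching of size three. -/
theorem not_five (m : Fin 5 → V → V) : ¬ IsRainbowFree m := by
  intro h
  obtain ⟨i, j, a, hij, ha, haj⟩ := h.exists_shared
  obtain ⟨k, hk, hik, hjk⟩ := exists_three_others i j hij
  obtain ⟨y, z, hy, hz, hyz, hyz', hya, hya', hza, hza'⟩ := h.exists_two_edges j a
  have iy := h.invol j y
  have iz := h.invol j z
  have ia := h.invol j a
  -- Two edges of `m j` avoid the first shared edge, so two of the other three matchings share an
  -- edge disjoint from it.
  obtain ⟨l, l', hll, u, e1, e2, e3, e4, e5, e6⟩ := h.exists_shared_of_two hij hik hjk hk ha hy hz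
    hyz hyz' (by rw [← haj]; refine ⟨hya, hya', fun e => hya' (by rw [e, ia]), fun e => hya ?_⟩
                 rw [← iy, e, ia])
    (by rw [← haj]; refine ⟨hza, hza', fun e => hza' (by rw [e, ia]), fun e => hza ?_⟩
        rw [← iz, e, ia])
  obtain ⟨q, q1, q2, q3, q4⟩ := exists_fifth i j k hk hik hjk l l' hll
  exact h.false_of_two_shared hij (hik l) (hik l') q1 (hjk l) (hjk l') q2 (hk.ne hll) q3 q4
    ha haj e2 e1.symm e3.symm e5.symm e4.symm e6.symm

end IsRainbowFree

/-! ### The excess inequality, gains and parity -/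

section LowerBounds

open scoped Classical

variable {L ι V : Type*} [Fintype V] {σ : L → L} {c : ι → V → L}

/-- The elements of colour `l` under the colouring `c j`. -/
noncomputable def colorClass (c : ι → V → L) (j : ι) (l : L) : Finset V :=
  Finset.univ.filter fun x => c j x = l

/-- The colours used by the colouring `c j`. -/
noncomputable def colors (c : ι → V → L) (j : ι) : Finset L :=
  Finset.univ.image (c j)

/-- The colours used exactly `k` times by the colouring `c j`. -/
noncomputable def colorsOfCard (c : ι → V → L) (k : ℕ) (j : ι) : Finset L :=
  (colors c j).filter fun l => (colorClass c j l).card = k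

@[simp]
theorem mem_colorClass {j : ι} {l : L} {x : V} : x ∈ colorClass c j l ↔ c j x = l := by
  simp [colorClass]

theorem mem_colors {j : ι} (x : V) : c j x ∈ colors c j :=
  Finset.mem_image_of_mem _ (Finset.mem_univ x)

theorem mem_colors_iff {j : ι} {l : L} : l ∈ colors c j ↔ (colorClass c j l).Nonempty := by
  simp [colors, Finset.Nonempty]

theorem mem_colorsOfCard {j : ι} {k : ℕ} {l : L} (hk : 0 < k) :
    l ∈ colorsOfCard c k j ↔ (colorClass c j l).card = k := by
  rw [colorsOfCard, Finset.mem_filter, mem_colors_iff, and_iff_right_iff_imp]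
  intro h
  rw [← Finset.card_pos]
  omega

theorem disjoint_colorClass {j : ι} {l l' : L} (h : l ≠ l') :
    Disjoint (colorClass c j l) (colorClass c j l') := by
  rw [Finset.disjoint_left]
  intro x hx hx'
  rw [mem_colorClass] at hx hx'
  exact h (hx.symm.trans hx')

theorem card_eq_sum_colorClass (j : ι) :
    Fintype.card V = ∑ l ∈ colors c j, (colorClass c j l).card := by
  rw [← Finset.card_univ, Finset.card_eq_sum_card_image (c j)]
  rfl

theorem Finset.even_card_of_involution {α : Type*} (s : Finset α) (g : α → α)
    (hg : ∀ a ∈ s, g a ∈ s) (hne : ∀ a, g a ≠ a) (hi : ∀ a, g (g a) = a) : Even s.card := by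
  have h : ∑ a ∈ s, (1 : ZMod 2) = 0 :=
    Finset.sum_involution (fun a _ => g a) (fun _ _ => by decide) (fun a _ _ => hne a)
      (fun a ha => hg a ha) (fun a _ => hi a)
  rw [Finset.sum_const, nsmul_eq_mul, mul_one] at h
  exact even_iff_two_dvd.2 ((ZMod.natCast_eq_zero_iff _ _).1 h)

namespace IsUPBColoring

/-- Some `y` avoids the colour of `x` under `c j` and the complements of the colours of `x`
elsewhere. It differs from `x`, and only `c j` can make the two orthogonal. -/
theorem opp_nonempty (h : IsUPBColoring σ c) (j : ι) (x : V) : (colorClass c j (σ (c j x))).Nonempty := by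
  obtain ⟨y, hy⟩ := h.unext fun i => if i = j then c j x else σ (c i x)
  have hyj := hy j
  rw [if_pos rfl] at hyj
  have hxy : x ≠ y := fun e => hyj (by rw [e])
  obtain ⟨i, hi⟩ := h.orth x y hxy
  have hyi := hy i
  by_cases hij : i = j
  · subst hij
    exact ⟨y, by simpa using hi⟩
  · rw [if_neg hij] at hyi
    exact absurd hi hyi

/-- Otherwise the points left uncovered inject into the colourings outside `S`, and each is covered
by its own class in the colouring assigned to it. -/
theorem excess [Fintype ι] (h : IsUPBColoring σ c) (S : Finset ι) (d : ι → L) :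
    (S.biUnion fun j => colorClass c j (d j)).card + Fintype.card ι < Fintype.card V + S.card := by
  by_contra! hcon
  let U : Finset V := (S.biUnion fun j => colorClass c j (d j))ᶜ
  have hU : Fintype.card U ≤ Fintype.card (Sᶜ : Finset ι) := by
    rw [Fintype.card_coe, Fintype.card_coe, Finset.card_compl, Finset.card_compl]
    have := Finset.card_le_univ S
    have := Finset.card_le_univ (S.biUnion fun j => colorClass c j (d j))
    omega
  obtain ⟨f⟩ := Function.Embedding.nonempty_of_card_le hU
  obtain ⟨x, hx⟩ := h.unext fun j => if hj : ∃ u : U, (f u : ι) = j then c j hj.choose else d j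
  have hxU : x ∈ U := by
    simp only [U, Finset.mem_compl, Finset.mem_biUnion, mem_colorClass, not_exists, not_and]
    intro j hj e
    refine hx j ?_
    rw [dif_neg, e]
    rintro ⟨u, hu⟩
    have := (f u).2
    rw [hu, Finset.mem_compl] at this
    exact this hj
  have hex : ∃ u : U, (f u : ι) = f ⟨x, hxU⟩ := ⟨⟨x, hxU⟩, rfl⟩
  refine hx (f ⟨x, hxU⟩) ?_
  rw [dif_pos hex]
  have := f.injective (Subtype.ext hex.choose_spec)
  rw [this]

theorem card_lt_card [Fintype ι] [Nonempty L] (h : IsUPBColoring σ c) :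
    Fintype.card ι < Fintype.card V := by
  simpa using h.excess ∅ fun _ => Classical.arbitrary L

theorem card_le_one [Fintype ι] (h : IsUPBColoring σ c) (j : ι) (l : L) :
    (colorClass c j l).card + Fintype.card ι ≤ Fintype.card V := by
  have := h.excess {j} fun _ => l
  simp at this
  omega

theorem card_union_two [Fintype ι] (h : IsUPBColoring σ c) {i j : ι} (hij : i ≠ j) (l l' : L) :
    (colorClass c i l ∪ colorClass c j l').card + Fintype.card ι < Fintype.card V + 2 := by
  have h1 := h.excess {i, j} fun k => if k = i then l else l'
  rw [Finset.card_pair hij, Finset.biUnion_insert, Finset.singleton_biUnion, if_pos rfl,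
    if_neg hij.symm] at h1
  exact h1

theorem card_union_three [Fintype ι] (h : IsUPBColoring σ c) {i j k : ι} (hij : i ≠ j) (hik : i ≠ k)
    (hjk : j ≠ k) (l l' l'' : L) :
    (colorClass c i l ∪ (colorClass c j l' ∪ colorClass c k l'')).card + Fintype.card ι <
      Fintype.card V + 3 := by
  have h1 := h.excess {i, j, k} fun q => if q = i then l else if q = j then l' else l''
  rw [Finset.card_eq_three.2 ⟨i, j, k, hij, hik, hjk, rfl⟩, Finset.biUnion_insert,
    Finset.biUnion_insert, Finset.singleton_biUnion, if_pos rfl, if_neg hij.symm, if_pos rfl,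
    if_neg hik.symm, if_neg hjk.symm] at h1
  exact h1

theorem card_le_biUnion [Fintype ι] (h : IsUPBColoring σ c) (x : V) :
    Fintype.card V ≤ (Finset.univ.biUnion fun j => colorClass c j (σ (c j x))).card + 1 := by
  have h1 : (Finset.univ : Finset V) ⊆
      insert x (Finset.univ.biUnion fun j => colorClass c j (σ (c j x))) := by
    intro y _
    rw [Finset.mem_insert, Finset.mem_biUnion]
    by_cases hxy : y = x
    · exact Or.inl hxy
    · obtain ⟨j, hj⟩ := h.orth x y (Ne.symm hxy)
      exact Or.inr ⟨j, Finset.mem_univ j, by simpa using hj⟩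
  exact (Finset.card_le_card h1).trans (Finset.card_insert_le _ _)

theorem card_le_sum [Fintype ι] (h : IsUPBColoring σ c) (x : V) :
    Fintype.card V ≤ ∑ j, (colorClass c j (σ (c j x))).card + 1 :=
  (h.card_le_biUnion x).trans (Nat.add_le_add_right Finset.card_biUnion_le 1)

/-- Each element gains at least `card V - card ι - 1` from classes of more than one element. -/
theorem card_le_sum_sub_one [Fintype ι] (h : IsUPBColoring σ c) (x : V) :
    Fintype.card V ≤ ∑ j, ((colorClass c j (σ (c j x))).card - 1) + Fintype.card ι + 1 := by
  refine (h.card_le_sum x).trans (Nat.add_le_add_right ?_ 1)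
  rw [← Finset.card_univ, Finset.card_eq_sum_ones, ← Finset.sum_add_distrib]
  exact Finset.sum_le_sum fun j _ => by omega

theorem opp_mem_colors (h : IsUPBColoring σ c) {j : ι} {l : L} (hl : l ∈ colors c j) :
    σ l ∈ colors c j := by
  obtain ⟨x, hx⟩ := mem_colors_iff.1 hl
  rw [mem_colorClass] at hx
  rw [mem_colors_iff, ← hx]
  exact h.opp_nonempty j x

theorem even_card_colors (h : IsUPBColoring σ c) (j : ι) : Even (colors c j).card :=
  Finset.even_card_of_involution _ σ (fun _ => h.opp_mem_colors) h.ne h.invol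

theorem sum_opp (h : IsUPBColoring σ c) (j : ι) (X : Finset V) (f : L → ℕ) :
    ∑ x ∈ X, f (σ (c j x)) = ∑ l ∈ colors c j, f l * (colorClass c j (σ l) ∩ X).card := by
  rw [← Finset.sum_fiberwise_of_maps_to (s := X) (t := colors c j) (g := fun x => σ (c j x))
    fun x _ => h.opp_mem_colors (mem_colors x)]
  refine Finset.sum_congr rfl fun l _ => ?_
  have h1 : X.filter (fun x => σ (c j x) = l) = colorClass c j (σ l) ∩ X := by
    ext x
    simp only [Finset.mem_filter, Finset.mem_inter, mem_colorClass, and_comm]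
    constructor
    · rintro ⟨h1, h2⟩
      exact ⟨by rw [← h1, h.invol], h2⟩
    · rintro ⟨h1, h2⟩
      exact ⟨by rw [h1, h.invol], h2⟩
  rw [← h1, mul_comm, ← smul_eq_mul, ← Finset.sum_const]
  exact Finset.sum_congr rfl fun x hx => by rw [(Finset.mem_filter.1 hx).2]

/-- The total gain over `X` of the `j`-th colouring, computed from its classes. -/
theorem sum_gain (h : IsUPBColoring σ c) (j : ι) (X : Finset V) :
    ∑ x ∈ X, ((colorClass c j (σ (c j x))).card - 1) =
      ∑ l ∈ colors c j, ((colorClass c j l).card - 1) * (colorClass c j (σ l) ∩ X).card :=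
  h.sum_opp j X fun l => (colorClass c j l).card - 1

/-- All classes are singletons, so there are as many points as colours in use. -/
theorem even_of_card_eq_add_one [Fintype ι] [Nonempty ι] (h : IsUPBColoring σ c)
    (hn : Fintype.card V = Fintype.card ι + 1) : Even (Fintype.card V) := by
  obtain ⟨j⟩ := ‹Nonempty ι›
  rw [card_eq_sum_colorClass (c := c) j, Finset.sum_congr rfl (g := fun _ => 1), Finset.sum_const,
    smul_eq_mul, mul_one]
  · exact h.even_card_colors j
  · intro l hl
    have := h.card_le_one j l
    have := Finset.card_pos.2 (mem_colors_iff.1 hl)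
    omega

/-! ### Two more states than qubits -/

section AddTwo

variable [Fintype ι]

theorem not_disjoint_of_add_two (h : IsUPBColoring σ c)
    (hn : Fintype.card V = Fintype.card ι + 2) {i j : ι} (hij : i ≠ j) {l l' : L}
    (hl : (colorClass c i l).card = 2) (hl' : (colorClass c j l').card = 2) :
    ¬ Disjoint (colorClass c i l) (colorClass c j l') := by
  intro hd
  have := h.card_union_two hij l l'
  rw [Finset.card_union_of_disjoint hd] at this
  omega

theorem card_eq_of_add_two (h : IsUPBColoring σ c)
    (hn : Fintype.card V = Fintype.card ι + 2) (j : ι) :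
    Fintype.card V = (colors c j).card + (colorsOfCard c 2 j).card := by
  rw [card_eq_sum_colorClass (c := c) j, colorsOfCard, Finset.card_filter,
    Finset.card_eq_sum_ones (colors c j), ← Finset.sum_add_distrib]
  refine Finset.sum_congr rfl fun l hl => ?_
  have := h.card_le_one j l
  have := Finset.card_pos.2 (mem_colors_iff.1 hl)
  split_ifs <;> omega

theorem exists_two_of_add_two (h : IsUPBColoring σ c)
    (hn : Fintype.card V = Fintype.card ι + 2) (x : V) :
    ∃ j, (colorClass c j (σ (c j x))).card = 2 := by
  by_contra! hcon
  have h1 := h.card_le_sum_sub_one x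
  rw [Finset.sum_eq_zero] at h1
  · omega
  · intro j _
    have := h.card_le_one j (σ (c j x))
    have := hcon j
    omega

/-- By `card_eq_of_add_two` the number of two-element classes is even. It is at most two, as these
disjoint classes all meet a fixed pair of `j`. -/
theorem card_colorsOfCard_of_add_two (h : IsUPBColoring σ c)
    (hn : Fintype.card V = Fintype.card ι + 2) (heven : Even (Fintype.card V)) {i j : ι}
    (hij : i ≠ j) (hi : (colorsOfCard c 2 i).Nonempty) (hj : (colorsOfCard c 2 j).Nonempty) :
    (colorsOfCard c 2 i).card = 2 := by
  obtain ⟨l, hl⟩ := hj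
  rw [mem_colorsOfCard two_pos] at hl
  have h1 : colorsOfCard c 2 i ⊆ (colorClass c j l).image (c i) := by
    intro l' hl'
    rw [mem_colorsOfCard two_pos] at hl'
    have := h.not_disjoint_of_add_two hn hij hl' hl
    rw [Finset.not_disjoint_iff] at this
    obtain ⟨x, hx, hx'⟩ := this
    exact Finset.mem_image.2 ⟨x, hx', mem_colorClass.1 hx⟩
  have h2 := (Finset.card_le_card h1).trans Finset.card_image_le
  have h3 := h.card_eq_of_add_two hn i
  have h4 := h.even_card_colors i
  have h5 := Finset.card_pos.2 hi
  rw [Nat.even_iff] at h4 heven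
  omega

theorem card_add_two_le (h : IsUPBColoring σ c)
    (hn : Fintype.card V = Fintype.card ι + 2) (hmod : Fintype.card V % 4 = 2) :
    Fintype.card V ≤ 8 := by
  have hle : ∀ j l, (colorClass c j l).card ≤ 2 := fun j l => by
    have := h.card_le_one j l
    omega
  have heven : Even (Fintype.card V) := by rw [Nat.even_iff]; omega
  let J : Finset ι := Finset.univ.filter fun j => (colorsOfCard c 2 j).Nonempty
  have hJ : ∀ j, j ∈ J ↔ (colorsOfCard c 2 j).Nonempty := fun j => by simp [J]
  have hVpos : 0 < Fintype.card V := by omega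
  obtain ⟨x0⟩ := Fintype.card_pos_iff.1 hVpos
  obtain ⟨i, hi⟩ := h.exists_two_of_add_two hn x0
  have hiJ : i ∈ J := (hJ i).2 ⟨_, (mem_colorsOfCard two_pos).2 hi⟩
  -- If `i` were alone in `J`, all its classes would be pairs; their number being even, `4` would
  -- divide the number of points.
  obtain ⟨j0, hj0J, hj0⟩ : ∃ j ∈ J, j ≠ i := by
    by_contra! hcon
    have h1 : ∀ l ∈ colors c i, (colorClass c i l).card = 2 := by
      intro l hl
      obtain ⟨x, hx⟩ := mem_colors_iff.1 (h.opp_mem_colors hl)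
      obtain ⟨j, hj⟩ := h.exists_two_of_add_two hn x
      have hji := hcon j ((hJ j).2 ⟨_, (mem_colorsOfCard two_pos).2 hj⟩)
      rw [hji, mem_colorClass.1 hx, h.invol] at hj
      exact hj
    have h2 := card_eq_sum_colorClass (c := c) i
    rw [Finset.sum_congr rfl h1, Finset.sum_const, smul_eq_mul] at h2
    have h3 := h.even_card_colors i
    rw [Nat.even_iff] at h3
    omega
  have hcard : ∀ j ∈ J, (colorsOfCard c 2 j).card = 2 := by
    intro j hj
    by_cases hji : j = i
    · exact h.card_colorsOfCard_of_add_two hn heven (hji ▸ hj0.symm : j ≠ j0) ((hJ j).1 hj)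
        ((hJ j0).1 hj0J)
    · exact h.card_colorsOfCard_of_add_two hn heven hji ((hJ j).1 hj) ((hJ i).1 hiJ)
  obtain ⟨l1, l2, hl12, hli⟩ := Finset.card_eq_two.1 (hcard i hiJ)
  have hl1 : (colorClass c i l1).card = 2 := (mem_colorsOfCard two_pos).1 (by rw [hli]; simp)
  have hl2 : (colorClass c i l2).card = 2 := (mem_colorsOfCard two_pos).1 (by rw [hli]; simp)
  let W := colorClass c i l1 ∪ colorClass c i l2
  have hW : W.card = 4 := by
    rw [Finset.card_union_of_disjoint (disjoint_colorClass hl12), hl1, hl2]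
  have hsub : ∀ j ∈ J, ∀ l, (colorClass c j l).card = 2 → colorClass c j l ⊆ W := by
    intro j _ l hl
    by_cases hji : j = i
    · subst hji
      have : l ∈ colorsOfCard c 2 j := (mem_colorsOfCard two_pos).2 hl
      rw [hli, Finset.mem_insert, Finset.mem_singleton] at this
      rcases this with rfl | rfl
      · exact Finset.subset_union_left
      · exact Finset.subset_union_right
    · obtain ⟨x, hx, hx1⟩ := Finset.not_disjoint_iff.1 (h.not_disjoint_of_add_two hn hji hl hl1)
      obtain ⟨y, hy, hy1⟩ := Finset.not_disjoint_iff.1 (h.not_disjoint_of_add_two hn hji hl hl2)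
      have hxy : x ≠ y := fun e => Finset.disjoint_left.1 (disjoint_colorClass hl12) hx1 (e ▸ hy1)
      have h1 : ({x, y} : Finset V) = colorClass c j l :=
        Finset.eq_of_subset_of_card_le (by
          rw [Finset.insert_subset_iff, Finset.singleton_subset_iff]; exact ⟨hx, hy⟩)
          (by rw [hl, Finset.card_pair hxy])
      rw [← h1, Finset.insert_subset_iff, Finset.singleton_subset_iff]
      exact ⟨Finset.mem_union_left _ hx1, Finset.mem_union_right _ hy1⟩
  obtain ⟨a, ha⟩ : (colorClass c i l1).Nonempty := Finset.card_pos.1 (by omega)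
  -- Each colouring in `J` splits `W` into two pairs. Off `i`, the partner of `a` lies in the second
  -- pair of `i`; different colourings give different partners, since equal pairs would leave
  -- disjoint ones.
  have hJcard : (J.erase i).card ≤ 2 := by
    have hcover : ∀ j ∈ J, ∃ l, (colorClass c j (c j a)).card = 2 ∧ l ≠ c j a ∧
        (colorClass c j l).card = 2 := by
      intro j hj
      obtain ⟨m1, m2, hm, hmj⟩ := Finset.card_eq_two.1 (hcard j hj)
      have hm1 : (colorClass c j m1).card = 2 := (mem_colorsOfCard two_pos).1 (by rw [hmj]; simp)
      have hm2 : (colorClass c j m2).card = 2 := (mem_colorsOfCard two_pos).1 (by rw [hmj]; simp)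
      have h1 : colorClass c j m1 ∪ colorClass c j m2 = W :=
        Finset.eq_of_subset_of_card_le (Finset.union_subset (hsub j hj _ hm1) (hsub j hj _ hm2))
          (by rw [hW, Finset.card_union_of_disjoint (disjoint_colorClass hm), hm1, hm2])
      have haW : a ∈ W := Finset.mem_union_left _ ha
      rw [← h1, Finset.mem_union, mem_colorClass, mem_colorClass] at haW
      rcases haW with e | e
      · exact ⟨m2, by rw [e, hm1], by rw [e]; exact hm.symm, hm2⟩
      · exact ⟨m1, by rw [e, hm2], by rw [e]; exact hm, hm1⟩
    rw [← hl2]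
    have hmeet : ∀ j ∈ J.erase i, ∃ x ∈ colorClass c i l2, c j x = c j a := by
      intro j hj
      rw [Finset.mem_erase] at hj
      obtain ⟨l, h1, -, -⟩ := hcover j hj.2
      obtain ⟨x, hx, hx1⟩ := Finset.not_disjoint_iff.1 (h.not_disjoint_of_add_two hn hj.1 h1 hl2)
      exact ⟨x, hx1, mem_colorClass.1 hx⟩
    have : Nonempty V := ⟨x0⟩
    choose! f hf hfa using hmeet
    refine Finset.card_le_card_of_injOn f hf ?_
    intro j hj k hk hjk
    by_contra hne
    have hj' := Finset.mem_of_mem_erase hj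
    have hk' := Finset.mem_of_mem_erase hk
    obtain ⟨l, h1, h2, h3⟩ := hcover j hj'
    obtain ⟨-, h1', -, -⟩ := hcover k hk'
    have hfne : a ≠ f j := fun e => by
      have := hf j hj
      rw [← e] at this
      exact Finset.disjoint_left.1 (disjoint_colorClass hl12) ha this
    have hset : ∀ q, (colorClass c q (c q a)).card = 2 → c q (f j) = c q a →
        ({a, f j} : Finset V) = colorClass c q (c q a) := fun q hq hqf =>
      Finset.eq_of_subset_of_card_le (by
        rw [Finset.insert_subset_iff, Finset.singleton_subset_iff, mem_colorClass, mem_colorClass]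
        exact ⟨rfl, hqf⟩) (by rw [hq, Finset.card_pair hfne])
    have e1 := hset j h1 (hfa j hj)
    have e2 := hset k h1' (by rw [hjk]; exact hfa k hk)
    refine h.not_disjoint_of_add_two hn hne h3 h1' ?_
    rw [← e2, e1]
    exact disjoint_colorClass h2
  -- Each of the two repeated colours contributes at most two: a complementary pair counts twice in
  -- the first sum and lies inside `W`; a complementary singleton counts at most once in each sum.
  have hgain : ∀ j ∈ J, ∑ x, ((colorClass c j (σ (c j x))).card - 1) +
      ∑ x ∈ Wᶜ, ((colorClass c j (σ (c j x))).card - 1) ≤ 4 := by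
    intro j hj
    rw [h.sum_gain, h.sum_gain, ← Finset.sum_add_distrib]
    rw [← Finset.sum_subset (Finset.filter_subset _ _ : colorsOfCard c 2 j ⊆ colors c j)]
    · refine (Finset.sum_le_card_nsmul _ _ 2 ?_).trans (by
        have h1 := hcard j hj
        rw [colorsOfCard] at h1
        rw [h1]; simp)
      intro l hl
      have h2 := (mem_colorsOfCard two_pos).1 hl
      rw [h2, Finset.inter_univ]
      have h3 := hle j (σ l)
      by_cases h4 : (colorClass c j (σ l)).card = 2
      · have h5 : colorClass c j (σ l) ∩ Wᶜ = ∅ := by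
          rw [← Finset.disjoint_iff_inter_eq_empty]
          exact Finset.disjoint_left.2 fun x hx hx' => Finset.mem_compl.1 hx' (hsub j hj _ h4 hx)
        rw [h5, h4]
        simp
      · have := Finset.card_le_card (Finset.inter_subset_left (s₁ := colorClass c j (σ l)) (s₂ := Wᶜ))
        omega
    · intro l hl hl'
      have h1 : (colorClass c j l).card ≠ 2 := fun e => hl' ((mem_colorsOfCard two_pos).2 e)
      have h2 := hle j l
      rw [show (colorClass c j l).card - 1 = 0 by omega]
      simp
  have hzero : ∀ j ∉ J, ∀ x, (colorClass c j (σ (c j x))).card - 1 = 0 := by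
    intro j hj x
    have h1 : (colorClass c j (σ (c j x))).card ≠ 2 := fun e =>
      hj ((hJ j).2 ⟨_, (mem_colorsOfCard two_pos).2 e⟩)
    have h2 := hle j (σ (c j x))
    omega
  have htot : ∀ X : Finset V, X.card ≤
      ∑ j ∈ J, ∑ x ∈ X, ((colorClass c j (σ (c j x))).card - 1) := by
    intro X
    rw [Finset.sum_comm, Finset.card_eq_sum_ones]
    refine Finset.sum_le_sum fun x _ => ?_
    rw [Finset.sum_subset (Finset.subset_univ J) fun j _ hj => hzero j hj x]
    have := h.card_le_sum_sub_one x
    omega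
  -- The total is `n + (n - 4) ≤ 3 * 4`.
  have h1 := htot Finset.univ
  have h2 := htot Wᶜ
  have h3 := Finset.sum_le_sum hgain
  rw [Finset.sum_add_distrib, Finset.sum_const, smul_eq_mul] at h3
  have h4 := Finset.card_erase_of_mem hiJ
  rw [Finset.card_compl, hW] at h2
  rw [Finset.card_univ] at h1
  omega

end AddTwo

end IsUPBColoring

end LowerBounds

/-! ### Three more states than qubits: sizes of the classes -/

section AddThree

open scoped Classical

variable {L ι V : Type*} [Fintype V] {σ : L → L} {c : ι → V → L}

namespace IsUPBColoring

variable [Fintype ι]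

/-- A triple and a disjoint pair would cover five points, where `excess` allows four. Likewise, in
`meet_pairs`, three disjoint pairs would cover six, where five are allowed. -/
theorem meet_three (h : IsUPBColoring σ c) (hn : Fintype.card V = Fintype.card ι + 3) {i j : ι}
    (hij : i ≠ j) {l : L} (hl : (colorClass c i l).card = 3) {u v : V} (huv : u ≠ v)
    (hc : c j u = c j v) : c i u = l ∨ c i v = l := by
  by_contra! hcon
  have h1 := h.card_union_two hij l (c j u)
  have h2 : insert u (insert v (colorClass c i l)) ⊆ colorClass c i l ∪ colorClass c j (c j u) := by
    intro x hx
    simp only [Finset.mem_insert, mem_colorClass, Finset.mem_union] at hx ⊢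
    rcases hx with rfl | rfl | hx
    · exact Or.inr rfl
    · exact Or.inr hc.symm
    · exact Or.inl hx
  have h3 := Finset.card_le_card h2
  rw [Finset.card_insert_of_notMem (by simp [huv, hcon.1]),
    Finset.card_insert_of_notMem (by simp [hcon.2]), hl] at h3
  omega

theorem meet_pairs (h : IsUPBColoring σ c) (hn : Fintype.card V = Fintype.card ι + 3) {i j k : ι}
    (hij : i ≠ j) (hik : i ≠ k) (hjk : j ≠ k) {x x' y y' z z' : V} (hx : x ≠ x') (hy : y ≠ y')
    (hz : z ≠ z') (hcx : c i x = c i x') (hcy : c j y = c j y') (hcz : c k z = c k z') :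
    (x = y ∨ x = y' ∨ x' = y ∨ x' = y') ∨ (x = z ∨ x = z' ∨ x' = z ∨ x' = z') ∨
      (y = z ∨ y = z' ∨ y' = z ∨ y' = z') := by
  by_contra! hcon
  have h1 := h.card_union_three hij hik hjk (c i x) (c j y) (c k z)
  have h2 : ({x, x', y, y', z, z'} : Finset V) ⊆
      colorClass c i (c i x) ∪ (colorClass c j (c j y) ∪ colorClass c k (c k z)) := by
    intro w hw
    simp only [Finset.mem_insert, Finset.mem_singleton, mem_colorClass, Finset.mem_union] at hw ⊢
    rcases hw with rfl | rfl | rfl | rfl | rfl | rfl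
    · exact Or.inl rfl
    · exact Or.inl hcx.symm
    · exact Or.inr (Or.inl rfl)
    · exact Or.inr (Or.inl hcy.symm)
    · exact Or.inr (Or.inr rfl)
    · exact Or.inr (Or.inr hcz.symm)
  have h3 := Finset.card_le_card h2
  have h4 : ({x, x', y, y', z, z'} : Finset V).card = 6 := by
    rw [Finset.card_insert_of_notMem, Finset.card_insert_of_notMem, Finset.card_insert_of_notMem,
      Finset.card_insert_of_notMem, Finset.card_pair hz] <;>
    · simp only [Finset.mem_insert, Finset.mem_singleton, not_or]
      tauto
  omega

theorem card_le_three (h : IsUPBColoring σ c) (hn : Fintype.card V = Fintype.card ι + 3) (j : ι)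
    (l : L) : (colorClass c j l).card ≤ 3 := by
  have := h.card_le_one j l
  omega

/-- Only the classes of two or three elements contribute to a sum weighted by size minus one. -/
theorem sum_colors_of_add_three (h : IsUPBColoring σ c)
    (hn : Fintype.card V = Fintype.card ι + 3) (j : ι) (f : L → ℕ) :
    ∑ l ∈ colors c j, ((colorClass c j l).card - 1) * f l =
      ∑ l ∈ colorsOfCard c 2 j, f l + ∑ l ∈ colorsOfCard c 3 j, 2 * f l := by
  rw [colorsOfCard, colorsOfCard, Finset.sum_filter, Finset.sum_filter, ← Finset.sum_add_distrib]
  refine Finset.sum_congr rfl fun l hl => ?_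
  have h1 := h.card_le_three hn j l
  have h2 := Finset.card_pos.2 (mem_colors_iff.1 hl)
  generalize (colorClass c j l).card = k at *
  interval_cases k <;> simp

theorem card_eq_of_add_three (h : IsUPBColoring σ c)
    (hn : Fintype.card V = Fintype.card ι + 3) (j : ι) :
    Fintype.card V =
      (colors c j).card + (colorsOfCard c 2 j).card + 2 * (colorsOfCard c 3 j).card := by
  have h1 := h.sum_colors_of_add_three hn j fun _ => 1
  simp only [mul_one, Finset.sum_const, smul_eq_mul] at h1
  have h2 := card_eq_sum_colorClass (c := c) j
  have h3 : ∑ l ∈ colors c j, (colorClass c j l).card =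
      ∑ l ∈ colors c j, ((colorClass c j l).card - 1) + (colors c j).card := by
    rw [Finset.card_eq_sum_ones, ← Finset.sum_add_distrib]
    refine Finset.sum_congr rfl fun l hl => ?_
    have := Finset.card_pos.2 (mem_colors_iff.1 hl)
    omega
  omega

theorem odd_card_colorsOfCard_two (h : IsUPBColoring σ c)
    (hn : Fintype.card V = Fintype.card ι + 3) (hodd : Odd (Fintype.card V)) (j : ι) :
    Odd (colorsOfCard c 2 j).card := by
  have h1 := h.card_eq_of_add_three hn j
  have h2 := h.even_card_colors j
  rw [Nat.even_iff] at h2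
  rw [Nat.odd_iff] at *
  omega

theorem exists_two_class (h : IsUPBColoring σ c)
    (hn : Fintype.card V = Fintype.card ι + 3) (hodd : Odd (Fintype.card V)) (j : ι) :
    ∃ l, (colorClass c j l).card = 2 := by
  obtain ⟨l, hl⟩ := Finset.card_pos.1 (h.odd_card_colorsOfCard_two hn hodd j).pos
  exact ⟨l, (mem_colorsOfCard two_pos).1 hl⟩

end IsUPBColoring

theorem exists_pair_of_one_lt_card {j : ι} {l : L} (hl : 1 < (colorClass c j l).card) :
    ∃ u v, u ≠ v ∧ c j u = l ∧ c j v = l := by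
  obtain ⟨u, hu, v, hv, huv⟩ := Finset.one_lt_card.1 hl
  exact ⟨u, v, huv, mem_colorClass.1 hu, mem_colorClass.1 hv⟩

theorem eq_or_eq_of_card_two {j : ι} {l : L} (hl : (colorClass c j l).card = 2) {u v x : V}
    (huv : u ≠ v) (hu : c j u = l) (hv : c j v = l) (hx : c j x = l) : x = u ∨ x = v := by
  by_contra! hcon
  have h1 : ({x, u, v} : Finset V) ⊆ colorClass c j l := by
    intro y hy
    simp only [Finset.mem_insert, Finset.mem_singleton] at hy
    rw [mem_colorClass]
    rcases hy with rfl | rfl | rfl <;> assumption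
  have h2 := Finset.card_le_card h1
  rw [Finset.card_eq_three.2 ⟨x, u, v, hcon.1, hcon.2, huv, rfl⟩] at h2
  omega

theorem exists_ne_ne_of_card [Fintype ι] (hι : 3 ≤ Fintype.card ι) (i j : ι) :
    ∃ k, k ≠ i ∧ k ≠ j := by
  have h1 : ({i, j} : Finset ι).card < (Finset.univ : Finset ι).card :=
    (Finset.card_le_two).trans_lt (by rw [Finset.card_univ]; omega)
  obtain ⟨k, -, hk⟩ := Finset.exists_mem_notMem_of_card_lt_card h1
  exact ⟨k, by simpa using hk⟩

namespace IsUPBColoring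

variable [Fintype ι]

/-- Any colouring leaves two others that have disjoint pairs of elements of equal colours. -/
theorem exists_disjoint_pairs (h : IsUPBColoring σ c)
    (hn : Fintype.card V = Fintype.card ι + 3) (hmod : Fintype.card V % 4 = 3)
    (hι : 3 ≤ Fintype.card ι) (i : ι) :
    ∃ j k, j ≠ i ∧ k ≠ i ∧ j ≠ k ∧ ∃ y y' z z', y ≠ y' ∧ z ≠ z' ∧ c j y = c j y' ∧ c k z = c k z' ∧
      y ≠ z ∧ y ≠ z' ∧ y' ≠ z ∧ y' ≠ z' := by
  by_contra hcon
  have hmeet : ∀ j k, j ≠ i → k ≠ i → j ≠ k → ∀ y y' z z', y ≠ y' → z ≠ z' → c j y = c j y' →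
      c k z = c k z' → y = z ∨ y = z' ∨ y' = z ∨ y' = z' := by
    intro j k hj hk hjk y y' z z' hy hz hcy hcz
    by_contra! h2
    exact hcon ⟨j, k, hj, hk, hjk, y, y', z, z', hy, hz, hcy, hcz, h2⟩
  clear hcon
  have hodd : Odd (Fintype.card V) := by rw [Nat.odd_iff]; omega
  -- A pair `zz'` of a third colouring meets a two-element class of `j`, so only its other point
  -- `w'` can lie in a larger class; removing `w'` leaves there a pair disjoint from `zz'`.
  have hle : ∀ j, j ≠ i → ∀ l, (colorClass c j l).card ≤ 2 := by
    intro j hj l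
    by_contra! hl
    obtain ⟨k, hki, hkj⟩ := exists_ne_ne_of_card hι i j
    obtain ⟨l', hl'⟩ := h.exists_two_class hn hodd j
    obtain ⟨l'', hl''⟩ := h.exists_two_class hn hodd k
    obtain ⟨y, y', hy, hcy, hcy'⟩ := exists_pair_of_one_lt_card (c := c) (j := j) (l := l') (by omega)
    obtain ⟨z, z', hz, hcz, hcz'⟩ :=
      exists_pair_of_one_lt_card (c := c) (j := k) (l := l'') (by omega)
    have hll : l ≠ l' := fun e => by rw [e] at hl; omega
    have h1 : ∃ w w', ({w, w'} : Finset V) = {z, z'} ∧ c j w = l' := by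
      rcases hmeet j k hj hki hkj.symm y y' z z' hy hz (hcy.trans hcy'.symm) (hcz.trans hcz'.symm)
        with e | e | e | e
      · exact ⟨z, z', rfl, e ▸ hcy⟩
      · exact ⟨z', z, Finset.pair_comm _ _, e ▸ hcy⟩
      · exact ⟨z, z', rfl, e ▸ hcy'⟩
      · exact ⟨z', z, Finset.pair_comm _ _, e ▸ hcy'⟩
    obtain ⟨w, w', hww, hw⟩ := h1
    have hzw : ∀ x, x = z ∨ x = z' → x = w ∨ x = w' := fun x hx => by
      have : x ∈ ({w, w'} : Finset V) := by rw [hww]; simpa using hx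
      simpa using this
    have h2 : 1 < ((colorClass c j l).erase w').card :=
      lt_of_lt_of_le (by omega) Finset.pred_card_le_card_erase
    obtain ⟨u, hu, v, hv, huv⟩ := Finset.one_lt_card.1 h2
    rw [Finset.mem_erase, mem_colorClass] at hu hv
    have hne : ∀ x, x ≠ w' ∧ c j x = l → x ≠ z ∧ x ≠ z' := by
      intro x hx
      have key : ¬ (x = w ∨ x = w') := by
        rintro (e | e)
        · exact hll (by rw [← hx.2, e, hw])
        · exact hx.1 e
      exact ⟨fun e => key (hzw x (Or.inl e)), fun e => key (hzw x (Or.inr e))⟩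
    have := hmeet j k hj hki hkj.symm u v z z' huv hz (hu.2.trans hv.2.symm) (hcz.trans hcz'.symm)
    have hu' := hne u hu
    have hv' := hne v hv
    tauto
  -- Otherwise too few points are orthogonal to `x`. Off `i`, a class with two elements covers two
  -- of them, and every further class meets it and adds at most one; `i` itself adds at most one
  -- more.
  have htwo : ∀ x, 2 ≤ (colorClass c i (σ (c i x))).card := by
    intro x
    by_contra! hx
    let N : ι → Finset V := fun j => colorClass c j (σ (c j x))
    have hN : ((Finset.univ.erase i).biUnion N).card ≤ Fintype.card ι := by
      by_cases hall : ∀ j ∈ Finset.univ.erase i, (N j).card ≤ 1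
      · refine Finset.card_biUnion_le.trans ((Finset.sum_le_card_nsmul _ _ 1 hall).trans ?_)
        rw [Finset.card_erase_of_mem (Finset.mem_univ i), Finset.card_univ]
        simp
      · push Not at hall
        obtain ⟨j, hj, hj2⟩ := hall
        have hji := Finset.ne_of_mem_erase hj
        have h1 : (Finset.univ.erase i).biUnion N ⊆
            N j ∪ ((Finset.univ.erase i).erase j).biUnion fun k => N k \ N j := by
          intro y hy
          rw [Finset.mem_biUnion] at hy
          obtain ⟨k, hk, hyk⟩ := hy
          rw [Finset.mem_union, Finset.mem_biUnion]
          by_cases hyj : y ∈ N j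
          · exact Or.inl hyj
          · refine Or.inr ⟨k, Finset.mem_erase.2 ⟨fun e => hyj (e ▸ hyk), hk⟩, ?_⟩
            exact Finset.mem_sdiff.2 ⟨hyk, hyj⟩
        have h2 : ∀ k ∈ (Finset.univ.erase i).erase j, (N k \ N j).card ≤ 1 := by
          intro k hk
          rw [Finset.mem_erase, Finset.mem_erase] at hk
          by_contra! h3
          obtain ⟨u, hu, v, hv, huv⟩ := Finset.one_lt_card.1 h3
          obtain ⟨y, hy, y', hy', hyy⟩ := Finset.one_lt_card.1 hj2
          rw [Finset.mem_sdiff] at hu hv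
          have h4 := hmeet j k hji hk.2.1 (Ne.symm hk.1) y y' u v hyy huv
            ((mem_colorClass.1 hy).trans (mem_colorClass.1 hy').symm)
            ((mem_colorClass.1 hu.1).trans (mem_colorClass.1 hv.1).symm)
          rcases h4 with e | e | e | e
          · exact hu.2 (e ▸ hy)
          · exact hv.2 (e ▸ hy)
          · exact hu.2 (e ▸ hy')
          · exact hv.2 (e ▸ hy')
        refine (Finset.card_le_card h1).trans ((Finset.card_union_le _ _).trans ?_)
        have h3 := Finset.card_biUnion_le.trans (Finset.sum_le_card_nsmul _ _ 1 h2)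
        rw [Finset.card_erase_of_mem hj, Finset.card_erase_of_mem (Finset.mem_univ i),
          Finset.card_univ] at h3
        have h4 := hle j hji (σ (c j x))
        simp only [smul_eq_mul, mul_one] at h3
        have h5 : (N j).card ≤ 2 := h4
        omega
    have h1 := h.card_le_biUnion x
    have h2 : (Finset.univ.biUnion N) = N i ∪ (Finset.univ.erase i).biUnion N := by
      rw [← Finset.biUnion_insert, Finset.insert_erase (Finset.mem_univ i)]
    have h3 : (Finset.univ.biUnion N).card ≤ _ := h2 ▸ Finset.card_union_le _ _
    have h4 : (N i).card < 2 := hx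
    have h5 : Fintype.card V ≤ (Finset.univ.biUnion N).card + 1 := h1
    omega
  have h3 : (colorsOfCard c 3 i).card ≤ 2 := by
    obtain ⟨k, hki, -⟩ := exists_ne_ne_of_card hι i i
    obtain ⟨l, hl⟩ := h.exists_two_class hn hodd k
    obtain ⟨z, z', hz, hcz, hcz'⟩ := exists_pair_of_one_lt_card (c := c) (j := k) (l := l) (by omega)
    have h1 : colorsOfCard c 3 i ⊆ {c i z, c i z'} := by
      intro l hl
      rw [mem_colorsOfCard (by norm_num)] at hl
      have := h.meet_three hn hki.symm hl hz (hcz.trans hcz'.symm)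
      rw [Finset.mem_insert, Finset.mem_singleton]
      exact this.imp Eq.symm Eq.symm
    exact (Finset.card_le_card h1).trans Finset.card_le_two
  have h4 : (colors c i).card = (colorsOfCard c 2 i).card + (colorsOfCard c 3 i).card := by
    rw [colorsOfCard, colorsOfCard, Finset.card_filter, Finset.card_filter,
      ← Finset.sum_add_distrib, Finset.card_eq_sum_ones]
    refine Finset.sum_congr rfl fun l hl => ?_
    obtain ⟨x, hx⟩ := mem_colors_iff.1 (h.opp_mem_colors hl)
    have h5 := htwo x
    rw [mem_colorClass.1 hx, h.invol] at h5
    have h6 := h.card_le_three hn i l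
    split_ifs <;> omega
  -- The number of points is twice the even number of colours plus the number of triples. Modulo `4`
  -- there would be three triples, but there are at most two.
  have h5 := h.card_eq_of_add_three hn i
  have h6 := h.even_card_colors i
  rw [Nat.even_iff] at h6
  omega

/-- Two disjoint pairs from other colourings form a set `U` of four points. A pair of `i` meets `U`,
and a triple meets both pairs, so contains two points of `U`. -/
theorem card_colorsOfCard_le (h : IsUPBColoring σ c)
    (hn : Fintype.card V = Fintype.card ι + 3) (hmod : Fintype.card V % 4 = 3)
    (hι : 3 ≤ Fintype.card ι) (i : ι) :
    (colorsOfCard c 2 i).card + 2 * (colorsOfCard c 3 i).card ≤ 4 := by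
  obtain ⟨j, k, hji, hki, hjk, y, y', z, z', hy, hz, hcy, hcz, e1, e2, e3, e4⟩ :=
    h.exists_disjoint_pairs hn hmod hι i
  let U : Finset V := {y, y', z, z'}
  have hU : U.card ≤ 4 := Finset.card_le_four
  have h1 : U.card = ∑ l ∈ colors c i, (U.filter fun x => c i x = l).card :=
    Finset.card_eq_sum_card_fiberwise fun x _ => mem_colors x
  have h2 : (colorsOfCard c 2 i).card + 2 * (colorsOfCard c 3 i).card =
      ∑ l ∈ colors c i, ((colorClass c i l).card - 1) := by
    have := h.sum_colors_of_add_three hn i fun _ => 1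
    simp only [mul_one, Finset.sum_const, smul_eq_mul] at this
    omega
  rw [h2]
  refine le_trans (Finset.sum_le_sum fun l hl => ?_) (h1 ▸ hU)
  have hpos := Finset.card_pos.2 (mem_colors_iff.1 hl)
  have hle := h.card_le_three hn i l
  by_cases hl3 : (colorClass c i l).card = 3
  · have k1 : ∃ u ∈ U, (u = y ∨ u = y') ∧ c i u = l := by
      rcases h.meet_three hn hji.symm hl3 hy hcy with e | e
      · exact ⟨y, by simp [U], Or.inl rfl, e⟩
      · exact ⟨y', by simp [U], Or.inr rfl, e⟩
    have k2 : ∃ u ∈ U, (u = z ∨ u = z') ∧ c i u = l := by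
      rcases h.meet_three hn hki.symm hl3 hz hcz with e | e
      · exact ⟨z, by simp [U], Or.inl rfl, e⟩
      · exact ⟨z', by simp [U], Or.inr rfl, e⟩
    obtain ⟨u, hu, huy, hul⟩ := k1
    obtain ⟨v, hv, hvz, hvl⟩ := k2
    have huv : u ≠ v := by
      rcases huy with rfl | rfl <;> rcases hvz with rfl | rfl <;> assumption
    rw [hl3]
    exact Finset.one_lt_card.2 ⟨u, Finset.mem_filter.2 ⟨hu, hul⟩, v, Finset.mem_filter.2 ⟨hv, hvl⟩, huv⟩
  · by_cases hl2 : (colorClass c i l).card = 2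
    · obtain ⟨x, x', hx, hcx, hcx'⟩ := exists_pair_of_one_lt_card (c := c) (j := i) (l := l) (by omega)
      have h3 := h.meet_pairs hn hji.symm hki.symm hjk hx hy hz (hcx.trans hcx'.symm) hcy hcz
      rw [hl2]
      refine Finset.card_pos.2 ?_
      have key : ∀ u ∈ U, u = x ∨ u = x' → (U.filter fun x => c i x = l).Nonempty := by
        rintro u hu (rfl | rfl)
        · exact ⟨u, Finset.mem_filter.2 ⟨hu, hcx⟩⟩
        · exact ⟨u, Finset.mem_filter.2 ⟨hu, hcx'⟩⟩
      rcases h3 with (e | e | e | e) | (e | e | e | e) | h3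
      · exact key y (by simp [U]) (Or.inl e.symm)
      · exact key y' (by simp [U]) (Or.inl e.symm)
      · exact key y (by simp [U]) (Or.inr e.symm)
      · exact key y' (by simp [U]) (Or.inr e.symm)
      · exact key z (by simp [U]) (Or.inl e.symm)
      · exact key z' (by simp [U]) (Or.inl e.symm)
      · exact key z (by simp [U]) (Or.inr e.symm)
      · exact key z' (by simp [U]) (Or.inr e.symm)
      · tauto
    · omega

end IsUPBColoring

end AddThree

/-! ### Three more states than qubits: counting gains -/

section AddThreeBound

open scoped Classical

variable {L ι V : Type*} [Fintype V] {σ : L → L} {c : ι → V → L}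

/-- The other element of the colour class of `x`, if that class has exactly two elements. -/
noncomputable def partner (c : ι → V → L) (j : ι) (x : V) : V :=
  if hx : ∃ y, y ≠ x ∧ c j y = c j x ∧ (colorClass c j (c j x)).card = 2 then hx.choose else x

theorem partner_of_two {j : ι} {x : V} (hx : (colorClass c j (c j x)).card = 2) :
    partner c j x ≠ x ∧ c j (partner c j x) = c j x := by
  have hex : ∃ y, y ≠ x ∧ c j y = c j x ∧ (colorClass c j (c j x)).card = 2 := by
    obtain ⟨u, v, huv, hu, hv⟩ := exists_pair_of_one_lt_card (c := c) (j := j) (l := c j x) (by omega)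
    by_cases hux : u = x
    · exact ⟨v, fun e => huv (hux.trans e.symm), hv, hx⟩
    · exact ⟨u, hux, hu, hx⟩
  rw [partner, dif_pos hex]
  exact ⟨hex.choose_spec.1, hex.choose_spec.2.1⟩

theorem partner_of_not_two {j : ι} {x : V} (hx : (colorClass c j (c j x)).card ≠ 2) :
    partner c j x = x := by
  rw [partner, dif_neg]
  rintro ⟨-, -, -, h2⟩
  exact hx h2

theorem color_partner (j : ι) (x : V) : c j (partner c j x) = c j x := by
  by_cases hx : (colorClass c j (c j x)).card = 2
  · exact (partner_of_two hx).2
  · rw [partner_of_not_two hx]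

theorem partner_partner (j : ι) (x : V) : partner c j (partner c j x) = x := by
  by_cases hx : (colorClass c j (c j x)).card = 2
  · have h1 := partner_of_two hx
    have h2 := partner_of_two (c := c) (j := j) (x := partner c j x) (by rw [h1.2, hx])
    have h3 := eq_or_eq_of_card_two hx h1.1.symm rfl h1.2 (h2.2.trans h1.2)
    exact h3.resolve_right h2.1
  · rw [partner_of_not_two hx, partner_of_not_two hx]

namespace IsUPBColoring

variable [Fintype ι]

/-- The pairs of such a colouring form a matching of size three, and `meet_pairs` excludes rainbow
matchings of size three. -/
theorem card_filter_three_le (h : IsUPBColoring σ c)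
    (hn : Fintype.card V = Fintype.card ι + 3) :
    (Finset.univ.filter fun j => (colorsOfCard c 2 j).card = 3).card ≤ 4 := by
  by_contra! hcon
  obtain ⟨f⟩ : Nonempty (Fin 5 ↪ (Finset.univ.filter fun j => (colorsOfCard c 2 j).card = 3)) :=
    Function.Embedding.nonempty_of_card_le (by rw [Fintype.card_fin, Fintype.card_coe]; exact hcon)
  refine IsRainbowFree.not_five (fun t => partner c (f t).1) ⟨fun t => partner_partner _, ?_, ?_⟩
  · intro t
    have ht := (Finset.mem_filter.1 (f t).2).2
    generalize (f t).1 = j at ht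
    obtain ⟨l1, l2, l3, h12, h13, h23, hl⟩ := Finset.card_eq_three.1 ht
    have hmem : ∀ l ∈ colorsOfCard c 2 j, ∃ x, c j x = l ∧ partner c j x ≠ x := fun l hl => by
      rw [mem_colorsOfCard two_pos] at hl
      obtain ⟨u, -, -, hu, -⟩ := exists_pair_of_one_lt_card (c := c) (j := j) (l := l) (by omega)
      exact ⟨u, hu, (partner_of_two (by rw [hu, hl])).1⟩
    obtain ⟨x1, e1, g1⟩ := hmem l1 (by rw [hl]; simp)
    obtain ⟨x2, e2, g2⟩ := hmem l2 (by rw [hl]; simp)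
    obtain ⟨x3, e3, g3⟩ := hmem l3 (by rw [hl]; simp)
    refine ⟨x1, x2, x3, g1, g2, g3, ?_, ?_, ?_, ?_, ?_, ?_⟩ <;> intro e
    · exact h12 (by rw [← e1, ← e2, e])
    · exact h13 (by rw [← e1, ← e3, e])
    · exact h23 (by rw [← e2, ← e3, e])
    · exact h12 (by rw [← e1, ← e2, ← e, color_partner (c := c)])
    · exact h13 (by rw [← e1, ← e3, ← e, color_partner (c := c)])
    · exact h23 (by rw [← e2, ← e3, ← e, color_partner (c := c)])
  · intro s t q hst hsq htq x y z hx hy hz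
    have hne : ∀ s t, s ≠ t → (f s).1 ≠ (f t).1 := fun s t hst e =>
      hst (f.injective (Subtype.ext e))
    exact h.meet_pairs hn (hne s t hst) (hne s q hsq) (hne t q htq) hx.symm hy.symm hz.symm
      (color_partner _ _).symm (color_partner _ _).symm (color_partner _ _).symm

theorem gain_eq (h : IsUPBColoring σ c) (hn : Fintype.card V = Fintype.card ι + 3) (j : ι)
    (X : Finset V) :
    ∑ x ∈ X, ((colorClass c j (σ (c j x))).card - 1) =
      ∑ l ∈ colorsOfCard c 2 j, (colorClass c j (σ l) ∩ X).card +
        ∑ l ∈ colorsOfCard c 3 j, 2 * (colorClass c j (σ l) ∩ X).card := by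
  rw [h.sum_gain, h.sum_colors_of_add_three hn]

theorem types (h : IsUPBColoring σ c)
    (hn : Fintype.card V = Fintype.card ι + 3) (hmod : Fintype.card V % 4 = 3)
    (hι : 3 ≤ Fintype.card ι) (j : ι) :
    ((colorsOfCard c 2 j).card = 1 ∧ (colorsOfCard c 3 j).card = 0) ∨
    ((colorsOfCard c 2 j).card = 3 ∧ (colorsOfCard c 3 j).card = 0) ∨
    ((colorsOfCard c 2 j).card = 1 ∧ (colorsOfCard c 3 j).card = 1) := by
  have h1 := h.card_colorsOfCard_le hn hmod hι j
  have h2 := h.odd_card_colorsOfCard_two hn (by rw [Nat.odd_iff]; omega) j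
  rw [Nat.odd_iff] at h2
  omega

theorem two_mul_card_le_sum_gain (h : IsUPBColoring σ c)
    (hn : Fintype.card V = Fintype.card ι + 3) (X : Finset V) :
    2 * X.card ≤ ∑ j, ∑ x ∈ X, ((colorClass c j (σ (c j x))).card - 1) := by
  rw [Finset.sum_comm, mul_comm, ← smul_eq_mul, ← Finset.sum_const]
  refine Finset.sum_le_sum fun x _ => ?_
  have := h.card_le_sum_sub_one x
  omega

/-- Without triples a colouring gains at most `1`, or `5` if it is one of the at most four with
three pairs. So `2 * (p + 3) ≤ p + 16` for `p` qubits, which fails for `p ≥ 12`. -/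
theorem exists_three_class (h : IsUPBColoring σ c)
    (hn : Fintype.card V = Fintype.card ι + 3) (hmod : Fintype.card V % 4 = 3)
    (hι : 12 ≤ Fintype.card ι) : ∃ i, (colorsOfCard c 3 i).card = 1 := by
  by_contra! hcon
  have h0 : ∀ j, colorsOfCard c 3 j = ∅ := fun j => by
    have := h.types hn hmod (by omega) j
    have := hcon j
    rw [← Finset.card_eq_zero]
    omega
  have hle : ∀ j, ∀ l, (colorClass c j l).card ≤ 2 := fun j l => by
    have h1 := h.card_le_three hn j l
    have h2 : (colorClass c j l).card ≠ 3 := fun e => by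
      have := (mem_colorsOfCard (c := c) (j := j) (l := l) three_pos).2 e
      simp [h0] at this
    omega
  have hgain : ∀ j, ∑ x, ((colorClass c j (σ (c j x))).card - 1) ≤
      1 + if (colorsOfCard c 2 j).card = 3 then 4 else 0 := by
    intro j
    rw [h.gain_eq hn, h0 j, Finset.sum_empty, add_zero]
    -- The number of pairs is odd, so `σ` cannot pair them off among themselves.
    have hex : ∃ l ∈ colorsOfCard c 2 j, (colorClass c j (σ l) ∩ Finset.univ).card ≤ 1 := by
      by_contra! hall
      have h1 : Even (colorsOfCard c 2 j).card := by
        refine Finset.even_card_of_involution _ σ (fun l hl => ?_) h.ne h.invol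
        have h2 := hall l hl
        rw [Finset.inter_univ] at h2
        rw [mem_colorsOfCard two_pos]
        have := hle j (σ l)
        omega
      have h2 := h.odd_card_colorsOfCard_two hn (by rw [Nat.odd_iff]; omega) j
      exact (Nat.not_even_iff_odd.2 h2) h1
    obtain ⟨l, hl, hl1⟩ := hex
    rw [← Finset.add_sum_erase _ _ hl]
    have h2 : ∑ l ∈ (colorsOfCard c 2 j).erase l, (colorClass c j (σ l) ∩ Finset.univ).card ≤
        ((colorsOfCard c 2 j).erase l).card • 2 :=
      Finset.sum_le_card_nsmul _ _ _ fun l' _ => by rw [Finset.inter_univ]; exact hle j _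
    rw [Finset.card_erase_of_mem hl, smul_eq_mul] at h2
    have h3 := h.types hn hmod (by omega) j
    split_ifs <;> omega
  have h1 := h.two_mul_card_le_sum_gain hn Finset.univ
  have h2 := h1.trans (Finset.sum_le_sum fun j _ => hgain j)
  rw [Finset.sum_add_distrib, ← Finset.sum_filter, Finset.sum_const, Finset.sum_const] at h2
  have h3 := h.card_filter_three_le hn
  simp only [Finset.card_univ, smul_eq_mul, mul_one] at h2
  omega

/-- Many colourings have more than one repeated colour, if some colouring uses a colour thrice. -/
theorem five_le_card_of_three_class (h : IsUPBColoring σ c)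
    (hn : Fintype.card V = Fintype.card ι + 3) (hmod : Fintype.card V % 4 = 3)
    (hι : 12 ≤ Fintype.card ι) {i : ι} (hi : (colorsOfCard c 3 i).card = 1) :
    5 ≤ (Finset.univ.filter fun j => j ≠ i ∧
      ((colorsOfCard c 2 j).card = 3 ∨ (colorsOfCard c 3 j).card = 1)).card := by
  obtain ⟨a, ha⟩ := Finset.card_eq_one.1 hi
  have hti := h.types hn hmod (by omega) i
  obtain ⟨d, hd⟩ := Finset.card_eq_one.1 (show (colorsOfCard c 2 i).card = 1 by omega)
  have haA : (colorClass c i a).card = 3 := (mem_colorsOfCard three_pos).1 (by rw [ha]; simp)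
  have hdD : (colorClass c i d).card = 2 := (mem_colorsOfCard two_pos).1 (by rw [hd]; simp)
  -- Off the triple of `i`, classes of the other colourings have at most one point, by `meet_three`.
  -- So a further colouring gains at most `1` there, or `3` if it has more than one repeated colour,
  -- while a total of twice the number of qubits is needed.
  let X : Finset V := (colorClass c i a)ᶜ
  have hX : X.card = Fintype.card ι := by rw [Finset.card_compl, haA]; omega
  have hgi : ∑ x ∈ X, ((colorClass c i (σ (c i x))).card - 1) ≤ 4 := by
    rw [h.gain_eq hn, ha, hd, Finset.sum_singleton, Finset.sum_singleton]
    have hthree : ∀ l, (colorClass c i l).card = 3 → l = a := fun l hl => by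
      have := (mem_colorsOfCard (c := c) three_pos).2 hl
      rwa [ha, Finset.mem_singleton] at this
    have htwo : ∀ l, (colorClass c i l).card = 2 → l = d := fun l hl => by
      have := (mem_colorsOfCard (c := c) two_pos).2 hl
      rwa [hd, Finset.mem_singleton] at this
    have h1 : (colorClass c i (σ a) ∩ X).card ≤ (colorClass c i (σ a)).card :=
      Finset.card_le_card Finset.inter_subset_left
    have h2 : (colorClass c i (σ d) ∩ X).card ≤ (colorClass c i (σ d)).card :=
      Finset.card_le_card Finset.inter_subset_left
    have h3 := h.card_le_three hn i (σ a)
    have h4 := h.card_le_three hn i (σ d)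
    have h5 : (colorClass c i (σ a)).card ≠ 3 := fun e => h.ne a (hthree _ e)
    have h6 : (colorClass c i (σ d)).card ≠ 2 := fun e => h.ne d (htwo _ e)
    by_cases had : σ a = d
    · have : σ d = a := by rw [← had, h.invol]
      rw [this, show colorClass c i a ∩ X = ∅ by simp [X]]
      simp
      omega
    · have h7 : (colorClass c i (σ a)).card ≠ 2 := fun e => had (htwo _ e)
      have h8 : (colorClass c i (σ d)).card ≠ 3 := fun e => had (by rw [← hthree _ e, h.invol])
      omega
  have hgj : ∀ j ∈ Finset.univ.erase i, ∑ x ∈ X, ((colorClass c j (σ (c j x))).card - 1) ≤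
      1 + if j ≠ i ∧ ((colorsOfCard c 2 j).card = 3 ∨ (colorsOfCard c 3 j).card = 1)
        then 2 else 0 := by
    intro j hj
    have hji := Finset.ne_of_mem_erase hj
    have hone : ∀ l, (colorClass c j l ∩ X).card ≤ 1 := by
      intro l
      by_contra! h1
      obtain ⟨u, hu, v, hv, huv⟩ := Finset.one_lt_card.1 h1
      simp only [X, Finset.mem_inter, Finset.mem_compl, mem_colorClass] at hu hv
      rcases h.meet_three hn hji.symm haA huv (hu.1.trans hv.1.symm) with e | e
      · exact hu.2 e
      · exact hv.2 e
    rw [h.gain_eq hn]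
    have h1 := Finset.sum_le_card_nsmul (colorsOfCard c 2 j)
      (fun l => (colorClass c j (σ l) ∩ X).card) 1 fun l _ => hone _
    have h2 := Finset.sum_le_card_nsmul (colorsOfCard c 3 j)
      (fun l => 2 * (colorClass c j (σ l) ∩ X).card) 2 fun l _ => by have := hone (σ l); omega
    simp only [smul_eq_mul] at h1 h2
    have h3 := h.types hn hmod (by omega) j
    split_ifs with h4
    · omega
    · have h5 : ¬ ((colorsOfCard c 2 j).card = 3 ∨ (colorsOfCard c 3 j).card = 1) :=
        fun e => h4 ⟨hji, e⟩
      omega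
  have h1 := h.two_mul_card_le_sum_gain hn X
  rw [← Finset.add_sum_erase _ _ (Finset.mem_univ i), hX] at h1
  have h2 := Finset.sum_le_sum hgj
  rw [Finset.sum_add_distrib, ← Finset.sum_filter, Finset.sum_const, Finset.sum_const,
    Finset.card_erase_of_mem (Finset.mem_univ i), Finset.card_univ] at h2
  have h3 := Finset.card_le_card (Finset.filter_subset_filter
    (fun j => j ≠ i ∧ ((colorsOfCard c 2 j).card = 3 ∨ (colorsOfCard c 3 j).card = 1))
    (Finset.erase_subset i Finset.univ))
  simp only [smul_eq_mul, mul_one] at h2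
  omega

end IsUPBColoring

end AddThreeBound

/-! ### Three more states than qubits: colourings with triples -/

section AddThreeElim

open scoped Classical

variable {L ι V : Type*} [Fintype V] {σ : L → L} {c : ι → V → L}

/-- Two colourings `i`, `j` have the three-element classes `{a, b, e}` and `{a, b, f}`. -/
structure IsThreePair (c : ι → V → L) (i j : ι) (a b e f : V) : Prop where
  ab : a ≠ b
  ae : a ≠ e
  af : a ≠ f
  be : b ≠ e
  bf : b ≠ f
  ef : e ≠ f
  left : ∀ k, k ≠ i → ∀ u v, u ≠ v → c k u = c k v →
    (u = a ∨ u = b ∨ u = e) ∨ (v = a ∨ v = b ∨ v = e)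
  right : ∀ k, k ≠ j → ∀ u v, u ≠ v → c k u = c k v →
    (u = a ∨ u = b ∨ u = f) ∨ (v = a ∨ v = b ∨ v = f)

namespace IsUPBColoring

variable [Fintype ι]

/-- No two points of one triple lie off the other, so the triples share at least two points. They
differ: a two-element class of `i` is disjoint from the triple of `i` but meets that of `j`. -/
theorem exists_isThreePair (h : IsUPBColoring σ c)
    (hn : Fintype.card V = Fintype.card ι + 3) (hodd : Odd (Fintype.card V)) {i j : ι} (hij : i ≠ j)
    {l l' : L} (hl : (colorClass c i l).card = 3) (hl' : (colorClass c j l').card = 3) :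
    ∃ a b e f, IsThreePair c i j a b e f := by
  have hne : colorClass c i l ≠ colorClass c j l' := by
    intro heq
    obtain ⟨m, hm⟩ := h.exists_two_class hn hodd i
    obtain ⟨u, v, huv, hu, hv⟩ := exists_pair_of_one_lt_card (c := c) (j := i) (l := m) (by omega)
    have hml : m ≠ l := fun e => by rw [e, hl] at hm; omega
    rcases h.meet_three hn hij.symm hl' huv (hu.trans hv.symm) with e | e
    · have : u ∈ colorClass c i l := by rw [heq]; exact mem_colorClass.2 e
      exact hml (by rw [← hu, mem_colorClass.1 this])
    · have : v ∈ colorClass c i l := by rw [heq]; exact mem_colorClass.2 e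
      exact hml (by rw [← hv, mem_colorClass.1 this])
  have hsd : (colorClass c j l' \ colorClass c i l).card ≤ 1 := by
    by_contra! h1
    obtain ⟨u, hu, v, hv, huv⟩ := Finset.one_lt_card.1 h1
    simp only [Finset.mem_sdiff, mem_colorClass] at hu hv
    rcases h.meet_three hn hij hl huv (hu.1.trans hv.1.symm) with e | e
    · exact hu.2 e
    · exact hv.2 e
  have hsd' : (colorClass c j l' \ colorClass c i l).card ≠ 0 := by
    rw [Finset.card_ne_zero, Finset.sdiff_nonempty]
    exact fun hsub => hne (Finset.eq_of_subset_of_card_le hsub (by rw [hl, hl'])).symm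
  have h1 := Finset.card_sdiff_add_card_inter (colorClass c j l') (colorClass c i l)
  have h2 := Finset.card_sdiff_add_card_inter (colorClass c i l) (colorClass c j l')
  rw [Finset.inter_comm] at h2
  obtain ⟨f, hf⟩ := Finset.card_eq_one.1 (show (colorClass c j l' \ colorClass c i l).card = 1 by omega)
  obtain ⟨e, he⟩ := Finset.card_eq_one.1 (show (colorClass c i l \ colorClass c j l').card = 1 by omega)
  obtain ⟨a, b, hab, hin⟩ := Finset.card_eq_two.1
    (show (colorClass c j l' ∩ colorClass c i l).card = 2 by omega)
  have memf : ∀ x, (c j x = l' ∧ c i x ≠ l) ↔ x = f := fun x => by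
    simpa using Finset.ext_iff.1 hf x
  have meme : ∀ x, (c i x = l ∧ c j x ≠ l') ↔ x = e := fun x => by
    simpa using Finset.ext_iff.1 he x
  have memab : ∀ x, (c j x = l' ∧ c i x = l) ↔ (x = a ∨ x = b) := fun x => by
    simpa using Finset.ext_iff.1 hin x
  have hf' := (memf f).2 rfl
  have he' := (meme e).2 rfl
  have ha' := (memab a).2 (Or.inl rfl)
  have hb' := (memab b).2 (Or.inr rfl)
  refine ⟨a, b, e, f, hab, ?_, ?_, ?_, ?_, ?_, ?_, ?_⟩
  · rintro rfl; exact he'.2 ha'.1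
  · rintro rfl; exact hf'.2 ha'.2
  · rintro rfl; exact he'.2 hb'.1
  · rintro rfl; exact hf'.2 hb'.2
  · rintro rfl; exact hf'.2 he'.1
  · have key : ∀ x, c i x = l → x = a ∨ x = b ∨ x = e := fun x hx => by
      by_cases hx' : c j x = l'
      · have := (memab x).1 ⟨hx', hx⟩
        tauto
      · exact Or.inr (Or.inr ((meme x).1 ⟨hx, hx'⟩))
    intro k hk u v huv hc
    exact (h.meet_three hn hk.symm hl huv hc).imp (key u) (key v)
  · have key : ∀ x, c j x = l' → x = a ∨ x = b ∨ x = f := fun x hx => by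
      by_cases hx' : c i x = l
      · have := (memab x).1 ⟨hx, hx'⟩
        tauto
      · exact Or.inr (Or.inr ((memf x).1 ⟨hx, hx'⟩))
    intro k hk u v huv hc
    exact (h.meet_three hn hk.symm hl' huv hc).imp (key u) (key v)

end IsUPBColoring

namespace IsThreePair

variable {i j k : ι} {a b e f : V}

/-- A third colouring with three two-element classes has `{e, f}` as one of them, and the others
contain `a` and `b`. -/
theorem of_three_two (t : IsThreePair c i j a b e f) (hki : k ≠ i) (hkj : k ≠ j)
    (hk : (colorsOfCard c 2 k).card = 3) :
    c k e = c k f ∧ c k a ≠ c k b ∧ c k a ≠ c k e ∧ c k b ≠ c k e ∧ (∃ y, y ≠ a ∧ c k y = c k a) ∧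
      ∃ z, z ≠ b ∧ c k z = c k b := by
  -- Every repeated colour occurs at `a`, `b` or `g`, so three repeated colours are exactly theirs.
  -- Comparing `g = e` with `g = f` gives the common colour of `e` and `f`.
  have key : ∀ g, (∀ u v, u ≠ v → c k u = c k v →
      (u = a ∨ u = b ∨ u = g) ∨ (v = a ∨ v = b ∨ v = g)) →
      colorsOfCard c 2 k = {c k a, c k b, c k g} := by
    intro g hg
    refine Finset.eq_of_subset_of_card_le ?_ (by rw [hk]; exact Finset.card_le_three)
    intro l hl
    rw [mem_colorsOfCard two_pos] at hl
    obtain ⟨u, v, huv, hu, hv⟩ := exists_pair_of_one_lt_card (c := c) (j := k) (l := l) (by omega)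
    have := hg u v huv (hu.trans hv.symm)
    simp only [Finset.mem_insert, Finset.mem_singleton]
    rcases this with (rfl | rfl | rfl) | (rfl | rfl | rfl) <;> tauto
  have he := key e (t.left k hki)
  have hf := key f (t.right k hkj)
  have hcard := hk
  rw [he] at hcard
  have hab : c k a ≠ c k b := fun e1 => by
    rw [e1, Finset.insert_eq_of_mem (by simp)] at hcard
    have := Finset.card_le_two (a := c k b) (b := c k e)
    omega
  have hae : c k a ≠ c k e := fun e1 => by
    rw [e1, Finset.insert_eq_of_mem (by simp)] at hcard
    have := Finset.card_le_two (a := c k b) (b := c k e)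
    omega
  have hbe : c k b ≠ c k e := fun e1 => by
    rw [e1, Finset.pair_eq_singleton] at hcard
    have := Finset.card_le_two (a := c k a) (b := c k e)
    omega
  have hef : c k e = c k f := by
    have h1 : c k e ∈ colorsOfCard c 2 k := by rw [he]; simp
    rw [hf] at h1
    simp only [Finset.mem_insert, Finset.mem_singleton] at h1
    rcases h1 with h1 | h1 | h1
    · exact absurd h1.symm hae
    · exact absurd h1.symm hbe
    · exact h1
  have hpair : ∀ x, c k x ∈ colorsOfCard c 2 k → ∃ y, y ≠ x ∧ c k y = c k x := fun x hx => by
    rw [mem_colorsOfCard two_pos] at hx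
    exact ⟨partner c k x, partner_of_two hx⟩
  exact ⟨hef, hab, hae, hbe, hpair a (by rw [he]; simp), hpair b (by rw [he]; simp)⟩

/-- A third colouring with a three-element class. -/
theorem of_three_class (t : IsThreePair c i j a b e f) (hki : k ≠ i) (hkj : k ≠ j) {l l' : L}
    (hl : (colorClass c k l).card = 3) (hl' : (colorClass c k l').card = 2) :
    c k e = c k f ∧ ((c k a = l ∧ c k b = l ∧ c k e ≠ l) ∨ (c k a = l ∧ c k e = l ∧ c k b ≠ l) ∨
      (c k b = l ∧ c k e = l ∧ c k a ≠ l)) := by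
  have hll : l' ≠ l := fun e => by rw [e, hl] at hl'; omega
  -- At most one point of the triple lies outside `{a, b, g}`, and the pair has a point inside.
  have key : ∀ g, (∀ u v, u ≠ v → c k u = c k v →
      (u = a ∨ u = b ∨ u = g) ∨ (v = a ∨ v = b ∨ v = g)) →
      (c k a = l' ∧ c k b = l ∧ c k g = l) ∨ (c k b = l' ∧ c k a = l ∧ c k g = l) ∨
      (c k g = l' ∧ c k a = l ∧ c k b = l) := by
    intro g hg
    have h1 : c k a = l' ∨ c k b = l' ∨ c k g = l' := by
      obtain ⟨u, v, huv, hu, hv⟩ := exists_pair_of_one_lt_card (c := c) (j := k) (l := l') (by omega)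
      rcases hg u v huv (hu.trans hv.symm) with (rfl | rfl | rfl) | (rfl | rfl | rfl) <;> tauto
    obtain ⟨u, v, w, huv, huw, hvw, hs⟩ := Finset.card_eq_three.1 hl
    have hm : ∀ x ∈ ({u, v, w} : Finset V), c k x = l := fun x hx => by
      rw [← hs] at hx; exact mem_colorClass.1 hx
    have hu := hm u (by simp)
    have hv := hm v (by simp)
    have hw := hm w (by simp)
    have g1 := hg u v huv (hu.trans hv.symm)
    have g2 := hg u w huw (hu.trans hw.symm)
    have g3 := hg v w hvw (hv.trans hw.symm)
    clear hg hm hs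
    have two : ∀ x y, x ≠ y → (x = a ∨ x = b ∨ x = g) → (y = a ∨ y = b ∨ y = g) → c k x = l →
        c k y = l → (c k a = l ∧ c k b = l) ∨ (c k a = l ∧ c k g = l) ∨ (c k b = l ∧ c k g = l) := by
      rintro x y hxy (rfl | rfl | rfl) (rfl | rfl | rfl) hx hy <;>
        first
        | exact absurd rfl hxy
        | exact Or.inl ⟨hx, hy⟩
        | exact Or.inl ⟨hy, hx⟩
        | exact Or.inr (Or.inl ⟨hx, hy⟩)
        | exact Or.inr (Or.inl ⟨hy, hx⟩)
        | exact Or.inr (Or.inr ⟨hx, hy⟩)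
        | exact Or.inr (Or.inr ⟨hy, hx⟩)
    have h2 : (c k a = l ∧ c k b = l) ∨ (c k a = l ∧ c k g = l) ∨ (c k b = l ∧ c k g = l) := by
      rcases g1 with g1 | g1
      · rcases g3 with g3 | g3
        · exact two u v huv g1 g3 hu hv
        · exact two u w huw g1 g3 hu hw
      · rcases g2 with g2 | g2
        · exact two u v huv g2 g1 hu hv
        · exact two v w hvw g1 g2 hv hw
    clear two g1 g2 g3
    grind
  have h1 := key e (t.left k hki)
  have h2 := key f (t.right k hkj)
  clear key
  grind

end IsThreePair

namespace IsUPBColoring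

variable [Fintype ι]

/-- Beyond two colourings with a three-element class, at most two have more than one repeated
colour. -/
theorem card_filter_le_two (h : IsUPBColoring σ c)
    (hn : Fintype.card V = Fintype.card ι + 3) (hodd : Odd (Fintype.card V)) {i j : ι} (hij : i ≠ j)
    (hi : (colorsOfCard c 3 i).card = 1) (hj : (colorsOfCard c 3 j).card = 1) :
    (Finset.univ.filter fun k => k ≠ i ∧ k ≠ j ∧
      ((colorsOfCard c 2 k).card = 3 ∨ (colorsOfCard c 3 k).card = 1)).card ≤ 2 := by
  have hex : ∀ k, (colorsOfCard c 3 k).card = 1 → ∃ l, (colorClass c k l).card = 3 := fun k hk => by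
    obtain ⟨l, hl⟩ := Finset.card_eq_one.1 hk
    exact ⟨l, (mem_colorsOfCard three_pos).1 (by rw [hl]; simp)⟩
  obtain ⟨li, hli⟩ := hex i hi
  obtain ⟨lj, hlj⟩ := hex j hj
  obtain ⟨a, b, e, f, t⟩ := h.exists_isThreePair hn hodd hij hli hlj
  let M : Finset ι := Finset.univ.filter fun k => k ≠ i ∧ k ≠ j ∧
    ((colorsOfCard c 2 k).card = 3 ∨ (colorsOfCard c 3 k).card = 1)
  have hT : ∀ k ∈ M, (colorsOfCard c 3 k).card = 1 → ∃ l, (colorClass c k l).card = 3 ∧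
      ((c k a = l ∧ c k b = l ∧ c k e ≠ l) ∨ (c k a = l ∧ c k e = l ∧ c k b ≠ l) ∨
      (c k b = l ∧ c k e = l ∧ c k a ≠ l)) := by
    intro k hk hk3
    simp only [M, Finset.mem_filter, Finset.mem_univ, true_and] at hk
    obtain ⟨l, hl⟩ := hex k hk3
    obtain ⟨l', hl'⟩ := h.exists_two_class hn hodd k
    exact ⟨l, hl, (t.of_three_class hk.1 hk.2.1 hl hl').2⟩
  have hef : ∀ k ∈ M, c k e = c k f := by
    intro k hk
    simp only [M, Finset.mem_filter, Finset.mem_univ, true_and] at hk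
    rcases hk.2.2 with hk2 | hk3
    · exact (t.of_three_two hk.1 hk.2.1 hk2).1
    · obtain ⟨l, hl⟩ := hex k hk3
      obtain ⟨l', hl'⟩ := h.exists_two_class hn hodd k
      exact (t.of_three_class hk.1 hk.2.1 hl hl').1
  have hH : ∀ k ∈ M, (colorsOfCard c 3 k).card ≠ 1 →
      c k a ≠ c k b ∧ c k a ≠ c k e ∧ c k b ≠ c k e ∧ (∃ y, y ≠ a ∧ c k y = c k a) ∧
      ∃ z, z ≠ b ∧ c k z = c k b := by
    intro k hk hk3
    simp only [M, Finset.mem_filter, Finset.mem_univ, true_and] at hk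
    exact (t.of_three_two hk.1 hk.2.1 (hk.2.2.resolve_right hk3)).2
  -- The equal colours of `e` and `f` under `q` force both points into the triple of `k`, together
  -- with one of `a`, `b`. If `q` had three pairs, its pair at the other of `a`, `b` would miss this
  -- triple.
  have hT' : ∀ k ∈ M, ∀ q ∈ M, q ≠ k → (colorsOfCard c 3 k).card = 1 →
      (colorsOfCard c 3 q).card = 1 ∧ ∃ l, (colorClass c k l).card = 3 ∧
      ((c k a = l ∧ c k e = l ∧ c k b ≠ l) ∨ (c k b = l ∧ c k e = l ∧ c k a ≠ l)) := by
    intro k hk q hq hqk hk3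
    obtain ⟨l, hl, hl2⟩ := hT k hk hk3
    have h1 : c k e = l := by
      rcases h.meet_three hn hqk.symm hl t.ef (hef q hq) with h1 | h1
      · exact h1
      · rw [hef k hk, h1]
    have hf1 : c k f = l := by rw [← hef k hk, h1]
    have h2 : (c k a = l ∧ c k e = l ∧ c k b ≠ l) ∨ (c k b = l ∧ c k e = l ∧ c k a ≠ l) := by
      rcases hl2 with h2 | h2 | h2
      · exact absurd h1 h2.2.2
      · exact Or.inl h2
      · exact Or.inr h2
    refine ⟨?_, l, hl, h2⟩
    by_contra hq3
    obtain ⟨q1, q2, q3, ⟨y, hy, hy'⟩, z, hz, hz'⟩ := hH q hq hq3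
    have hmem : ∀ g, c k g = l → g ≠ e → g ≠ f → ∀ x, c k x = l → x = e ∨ x = f ∨ x = g := by
      intro g hg hge hgf x hx
      have h3 : ({e, f, g} : Finset V) = colorClass c k l := by
        refine Finset.eq_of_subset_of_card_le ?_ ?_
        · intro w hw
          simp only [Finset.mem_insert, Finset.mem_singleton] at hw
          rw [mem_colorClass]
          rcases hw with rfl | rfl | rfl <;> assumption
        · rw [hl, Finset.card_eq_three.2 ⟨e, f, g, t.ef, hge.symm, hgf.symm, rfl⟩]
      have h4 : x ∈ ({e, f, g} : Finset V) := by rw [h3]; exact mem_colorClass.2 hx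
      simpa using h4
    have hefq := hef q hq
    rcases h2 with h2 | h2
    · rcases h.meet_three hn hqk.symm hl hz hz' with h3 | h3
      · rcases hmem a h2.1 t.ae t.af z h3 with rfl | rfl | rfl
        · exact q3 hz'.symm
        · exact q3 (by rw [← hz', hefq])
        · exact q1 hz'
      · exact h2.2.2 h3
    · rcases h.meet_three hn hqk.symm hl hy hy' with h3 | h3
      · rcases hmem b h2.1 t.be t.bf y h3 with rfl | rfl | rfl
        · exact q2 hy'.symm
        · exact q2 (by rw [← hy', hefq])
        · exact q1 hy'.symm
      · exact h2.2.2 h3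
  -- A two-element class of `q` would miss the triple of `k`, which is also the triple of `q`.
  have hsame : ∀ g, g ≠ e → g ≠ f → ∀ k ∈ M, ∀ q ∈ M, q ≠ k → ∀ l l', (colorClass c k l).card = 3 →
      (colorClass c q l').card = 3 → c k g = l → c k e = l → c q g = l' → c q e = l' → False := by
    intro g hge hgf k hk q hq hqk l l' hl hl' h1 h2 h3 h4
    obtain ⟨m, hm⟩ := h.exists_two_class hn hodd q
    have hml : m ≠ l' := fun e => by rw [e, hl'] at hm; omega
    obtain ⟨u, v, huv, hu, hv⟩ := exists_pair_of_one_lt_card (c := c) (j := q) (l := m) (by omega)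
    have hset : ({e, f, g} : Finset V) = colorClass c k l := by
      refine Finset.eq_of_subset_of_card_le ?_ ?_
      · intro w hw
        simp only [Finset.mem_insert, Finset.mem_singleton] at hw
        rw [mem_colorClass]
        rcases hw with rfl | rfl | rfl
        · exact h2
        · rw [← hef k hk]; exact h2
        · exact h1
      · rw [hl, Finset.card_eq_three.2 ⟨e, f, g, t.ef, hge.symm, hgf.symm, rfl⟩]
    have hq' : ∀ x, c k x = l → c q x = l' := by
      intro x hx
      have h5 : x ∈ ({e, f, g} : Finset V) := by rw [hset]; exact mem_colorClass.2 hx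
      simp only [Finset.mem_insert, Finset.mem_singleton] at h5
      rcases h5 with rfl | rfl | rfl
      · exact h4
      · rw [← hef q hq]; exact h4
      · exact h3
    rcases h.meet_three hn hqk.symm hl huv (hu.trans hv.symm) with h5 | h5
    · exact hml (by rw [← hu, hq' u h5])
    · exact hml (by rw [← hv, hq' v h5])
  by_contra! hcon
  obtain ⟨k, q, r, hk, hq, hr, hkq, hkr, hqr⟩ := Finset.two_lt_card_iff.1 hcon
  -- Either all three colourings have triples, each `{e, f, a}` or `{e, f, b}`, so that two agree;
  -- or none has one.
  by_cases hk3 : (colorsOfCard c 3 k).card = 1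
  · obtain ⟨hq3, l1, hl1, t1⟩ := hT' k hk q hq hkq.symm hk3
    obtain ⟨hr3, l2, hl2, t2⟩ := hT' q hq r hr hqr.symm hq3
    obtain ⟨-, l3, hl3, t3⟩ := hT' r hr k hk hkr hr3
    have s1 := hsame a t.ae t.af
    have s2 := hsame b t.be t.bf
    rcases t1 with t1 | t1 <;> rcases t2 with t2 | t2 <;> rcases t3 with t3 | t3
    · exact s1 k hk q hq hkq.symm l1 l2 hl1 hl2 t1.1 t1.2.1 t2.1 t2.2.1
    · exact s1 k hk q hq hkq.symm l1 l2 hl1 hl2 t1.1 t1.2.1 t2.1 t2.2.1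
    · exact s1 k hk r hr hkr.symm l1 l3 hl1 hl3 t1.1 t1.2.1 t3.1 t3.2.1
    · exact s2 q hq r hr hqr.symm l2 l3 hl2 hl3 t2.1 t2.2.1 t3.1 t3.2.1
    · exact s1 q hq r hr hqr.symm l2 l3 hl2 hl3 t2.1 t2.2.1 t3.1 t3.2.1
    · exact s2 k hk r hr hkr.symm l1 l3 hl1 hl3 t1.1 t1.2.1 t3.1 t3.2.1
    · exact s2 k hk q hq hkq.symm l1 l2 hl1 hl2 t1.1 t1.2.1 t2.1 t2.2.1
    · exact s2 k hk q hq hkq.symm l1 l2 hl1 hl2 t1.1 t1.2.1 t2.1 t2.2.1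
  · have hq3 : (colorsOfCard c 3 q).card ≠ 1 := fun e => hk3 (hT' q hq k hk hkq e).1
    have hr3 : (colorsOfCard c 3 r).card ≠ 1 := fun e => hk3 (hT' r hr k hk hkr e).1
    obtain ⟨k1, k2, k3, ⟨y1, hy1, hy1'⟩, z1, hz1, hz1'⟩ := hH k hk hk3
    obtain ⟨q1, q2, q3, ⟨y2, hy2, hy2'⟩, z2, hz2, hz2'⟩ := hH q hq hq3
    obtain ⟨r1, r2, r3, ⟨y3, hy3, hy3'⟩, z3, hz3, hz3'⟩ := hH r hr hr3
    have ek := hef k hk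
    have eq := hef q hq
    have er := hef r hr
    -- A pair at `a`, a pair at `b` and `ef`, from the three colourings in different orders, give
    -- `y1 = z2 = y3 = z1`, although `a` and `b` have different colours under `k`.
    have m1 := h.meet_pairs hn hkq hkr hqr hy1 hz2 t.ef hy1' hz2' er
    have m3 := h.meet_pairs hn hkr.symm hqr.symm hkq hy3 hz1 t.ef hy3' hz1' eq
    have m5 := h.meet_pairs hn hqr.symm hkr.symm hkq.symm hy3 hz2 t.ef hy3' hz2' ek
    have n1 := t.ae
    have n2 := t.af
    have n3 := t.be
    have n4 := t.bf
    have n5 := t.ab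
    have sep : ∀ s y z, c s a ≠ c s b → c s a ≠ c s e → c s b ≠ c s e → c s e = c s f →
        c s y = c s a → c s z = c s b →
        y ≠ e ∧ y ≠ f ∧ y ≠ b ∧ z ≠ e ∧ z ≠ f ∧ z ≠ a ∧ y ≠ z := by
      intro s y z hab hae hbe hef hy hz
      refine ⟨?_, ?_, ?_, ?_, ?_, ?_, ?_⟩ <;> rintro rfl
      · exact hae hy.symm
      · exact hae (hy.symm.trans hef.symm)
      · exact hab hy.symm
      · exact hbe hz.symm
      · exact hbe (hz.symm.trans hef.symm)
      · exact hab hz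
      · exact hab (hy.symm.trans hz)
    have f1 := sep k y1 z1 k1 k2 k3 ek hy1' hz1'
    have f2 := sep q y2 z2 q1 q2 q3 eq hy2' hz2'
    have f3 := sep r y3 z3 r1 r2 r3 er hy3' hz3'
    have g1 : y1 = z2 := by
      simpa [f1.1, f1.2.1, f1.2.2.1, f2.2.2.2.1, f2.2.2.2.2.1, f2.2.2.2.2.2.1.symm, n1, n2, n3, n4,
        n5] using m1
    have g2 : y3 = z2 := by
      simpa [f3.1, f3.2.1, f3.2.2.1, f2.2.2.2.1, f2.2.2.2.2.1, f2.2.2.2.2.2.1.symm, n1, n2, n3, n4,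
        n5] using m5
    have g3 : y3 = z1 := by
      simpa [f3.1, f3.2.1, f3.2.2.1, f1.2.2.2.1, f1.2.2.2.2.1, f1.2.2.2.2.2.1.symm, n1, n2, n3, n4,
        n5] using m3
    exact f1.2.2.2.2.2.2 (by rw [g1, ← g2, g3])

/-- Five colourings besides `i` must have more than one repeated colour. A second triple leaves at
most three of them, no second triple at most four. -/
theorem card_ne_add_three (h : IsUPBColoring σ c) (hmod : Fintype.card V % 4 = 3)
    (hι : 12 ≤ Fintype.card ι) : Fintype.card V ≠ Fintype.card ι + 3 := by
  intro hn
  have hodd : Odd (Fintype.card V) := by rw [Nat.odd_iff]; omega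
  obtain ⟨i, hi⟩ := h.exists_three_class hn hmod hι
  have h5 := h.five_le_card_of_three_class hn hmod hι hi
  by_cases hex : ∃ j, j ≠ i ∧ (colorsOfCard c 3 j).card = 1
  · obtain ⟨j, hji, hj⟩ := hex
    have h2 := h.card_filter_le_two hn hodd hji.symm hi hj
    have hsub : (Finset.univ.filter fun k => k ≠ i ∧
        ((colorsOfCard c 2 k).card = 3 ∨ (colorsOfCard c 3 k).card = 1)) ⊆
        insert j (Finset.univ.filter fun k => k ≠ i ∧ k ≠ j ∧
          ((colorsOfCard c 2 k).card = 3 ∨ (colorsOfCard c 3 k).card = 1)) := by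
      intro k hk
      simp only [Finset.mem_filter, Finset.mem_univ, true_and, Finset.mem_insert] at hk ⊢
      tauto
    have h3 := (Finset.card_le_card hsub).trans (Finset.card_insert_le _ _)
    omega
  · push Not at hex
    have h4 := h.card_filter_three_le hn
    have hsub : (Finset.univ.filter fun k => k ≠ i ∧
        ((colorsOfCard c 2 k).card = 3 ∨ (colorsOfCard c 3 k).card = 1)) ⊆
        Finset.univ.filter fun k => (colorsOfCard c 2 k).card = 3 := by
      intro k hk
      simp only [Finset.mem_filter, Finset.mem_univ, true_and] at hk ⊢
      exact hk.2.resolve_right (hex k hk.1)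
    have h6 := Finset.card_le_card hsub
    omega

end IsUPBColoring

end AddThreeElim

/-! ### The bounds in terms of the number of qubits -/

theorem succ_le_of_mem_upbSizes {p n : ℕ} (hn : n ∈ upbSizes p) : p + 1 ≤ n := by
  obtain ⟨c, hc⟩ := exists_isUPBColoring hn
  simpa using hc.card_lt_card

theorem add_two_le_of_mem_upbSizes {p n : ℕ} (hp : Even p) (hp0 : 0 < p) (hn : n ∈ upbSizes p) :
    p + 2 ≤ n := by
  have h1 := succ_le_of_mem_upbSizes hn
  obtain ⟨c, hc⟩ := exists_isUPBColoring hn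
  have : Nonempty (Fin p) := ⟨⟨0, hp0⟩⟩
  by_contra! h2
  have h3 := hc.even_of_card_eq_add_one (by simp; omega)
  rw [Fintype.card_fin, Nat.even_iff] at h3
  rw [Nat.even_iff] at hp
  omega

theorem add_three_le_of_mem_upbSizes {p n : ℕ} (hp : p % 4 = 0) (hp8 : 8 ≤ p)
    (hn : n ∈ upbSizes p) : p + 3 ≤ n := by
  have h1 := add_two_le_of_mem_upbSizes (by rw [Nat.even_iff]; omega) (by omega) hn
  obtain ⟨c, hc⟩ := exists_isUPBColoring hn
  by_contra! h2
  have h3 := hc.card_add_two_le (by simp; omega) (by simp; omega)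
  rw [Fintype.card_fin] at h3
  omega

theorem add_four_le_of_mem_upbSizes {p n : ℕ} (hp : p % 4 = 0) (hp12 : 12 ≤ p)
    (hn : n ∈ upbSizes p) : p + 4 ≤ n := by
  have h1 := add_three_le_of_mem_upbSizes hp (by omega) hn
  obtain ⟨c, hc⟩ := exists_isUPBColoring hn
  by_contra! h2
  exact hc.card_ne_add_three (by simp; omega) (by simpa using hp12) (by simp; omega)

theorem theorem1 (p : ℕ) :
    (Odd p → IsLeast (upbSizes p) (p + 1)) ∧
    (p = 4 ∨ p ≡ 2 [MOD 4] → IsLeast (upbSizes p) (p + 2)) ∧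
    (p = 8 → IsLeast (upbSizes p) (p + 3)) ∧
    (p ≡ 0 [MOD 4] ∧ 12 ≤ p → IsLeast (upbSizes p) (p + 4)) := by
  refine ⟨fun hp => ⟨succ_mem_upbSizes_of_odd hp, fun n hn => succ_le_of_mem_upbSizes hn⟩, ?_, ?_, ?_⟩
  · rintro (rfl | hp)
    · exact ⟨six_mem_upbSizes, fun n hn => add_two_le_of_mem_upbSizes (by decide) (by decide) hn⟩
    · have h4 : p % 4 = 2 := hp
      exact ⟨add_two_mem_upbSizes hp, fun n hn =>
        add_two_le_of_mem_upbSizes (by rw [Nat.even_iff]; omega) (by omega) hn⟩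
  · rintro rfl
    exact ⟨eleven_mem_upbSizes, fun n hn => add_three_le_of_mem_upbSizes (by decide) le_rfl hn⟩
  · rintro ⟨hp, hp12⟩
    exact ⟨add_four_mem_upbSizes hp (by omega), fun n hn => add_four_le_of_mem_upbSizes hp hp12 hn⟩
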